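/- **Theorem (Jet Transversality Theorem, prevalence version).** Let $n,m,k\ge 0$ be integers, let $A\subset\mathbb R^n$ be open, and let $Z$ be a $C^r$ manifold of codimension $c$ in the jet space $J^k(\mathbb R^n,\mathbb R^m)$, where $\max(n-c,0)<r\le\infty$. Let $k+\max(n-c,0)<l\le\infty$. Then almost every $C^l$ function $f:A\to\mathbb R^m$ has the property that $j^kf:A\to J^k(\mathbb R^n,\mathbb R^m)$ is transversal to $Z$. Moreover, the space of (the restrictions to $A$ of) polynomials of degree $\le k$ from $\mathbb R^n$ to $\mathbb R^m$ is a probe for the set of these $f$. Here the following definitions are used. * $J^k(\mathbb R^n,\mathbb R^m)=\mathbb R^n\times P^k(\mathbb R^n,\mathbb R^m)$, where $P^k(\mathbb R^n,\mathbb R^m)$ is the space of polynomials of degree $\le k$ from $\mathbb R^n$ to $\mathbb R^m$, and $j^kf(x)=(x,f(x),Df(x),\dots,D^kf(x))$, where the coordinates $(f(x),\dots,D^kf(x))$ (in the spaces of symmetric $i$-linear maps, $0\le i\le k$) represent the polynomial of degree $\le k$ that has the same derivatives up to order $k$ as $f$ at $x$. * A subset $M$ of a finite-dimensional real vector space $G$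 is a $C^r$ manifold of dimension $d$ and codimension $c$ ($d+c=\dim G$) if every $x\in M$ has an open neighbourhood $U\subset G$ with a $C^r$ diffeomorphism $\varphi$ from $U$ onto an open set $V\subset\mathbb R^d\times\mathbb R^c$ such that $\varphi(M\cap U)=(\mathbb R^d\times\{0\})\cap V$. Then $T_xM$ is the inverse image of $\mathbb R^d\times\{0\}$ under $D\varphi(x)$. A $C^1$ function $F:A\to G$ is transversal to $M$ if, whenever $F(x)\in M$, the spaces $DF(x)(\mathbb R^n)$ and $T_{F(x)}M$ together span $G$. * Let $V$ be a complete metric linear space. A Borel measure $\mu$ on $V$ is transverse to a Borel set $S\subset V$ if $0<\mu(U)<\infty$ for some compact $U\subset V$, and $\mu(S+v)=0$ for every $v\in V$. A subset of $V$ is shy if it is contained in a Borel set to which some Borel measure is transverse, and prevalent if its complement is shy; "almost every element of $V$ has a property" means that the set of the elements with this property is prevalent. A finite-dimensional subspace $P\subset V$ is a probe for $T\subset V$ if Lebesgue measure supported on $P$ is transverse to a Borel set that contains the complement of $T$. These notions are applied to $V=C^l(A,\mathbb R^m)$ with the topology of uniform convergence on compact subsets of $A$ of all derivatives of (finite) order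 $\le l$. -/

import Mathlib

namespace JetTransversality

open Set Topology MeasureTheory TopologicalSpace
open scoped ENNReal

/-! ### Prevalence in a topological vector space -/

section Prevalence

variable {V : Type*} [AddCommGroup V] [TopologicalSpace V] [MeasurableSpace V] [BorelSpace V]

/-- The Borel measure `μ` is transverse to the (Borel) set `S`: some compact set has positive finite
measure, and every translate of `S` is `μ`-null. -/
def IsTransverse (μ : Measure V) (S : Set V) : Prop :=
  (∃ U : Set V, IsCompact U ∧ 0 < μ U ∧ μ U < ∞) ∧ ∀ v : V, μ ((fun s => s + v) '' S) = 0

/-- A set is shy if it is contained in a Borel set that has a transverse measure. -/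
def IsShy (S : Set V) : Prop :=
  ∃ B : Set V, S ⊆ B ∧ MeasurableSet B ∧ ∃ μ : Measure V, IsTransverse μ B

/-- A set is prevalent if its complement is shy. "Almost every `v` has a property" means that the
set of the `v` with this property is prevalent. -/
def IsPrevalent (T : Set V) : Prop := IsShy Tᶜ

variable [Module ℝ V]

/-- Lebesgue measure supported on the span of a finite family `b` of (linearly independent) vectors,
as a Borel measure on the whole space. Another basis of the span only changes it by a constant. -/
noncomputable def lebesgueOnSpan {N : ℕ} (b : Fin N → V) : Measure V :=
  Measure.map (fun t : Fin N → ℝ => ∑ i, t i • b i) volume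

/-- A finite-dimensional subspace `P` is a probe for `T` if Lebesgue measure supported on `P` is
transverse to a Borel set that contains the complement of `T`. -/
def IsProbe (P : Submodule ℝ V) (T : Set V) : Prop :=
  ∃ (N : ℕ) (b : Module.Basis (Fin N) ℝ P) (B : Set V),
    Tᶜ ⊆ B ∧ MeasurableSet B ∧ IsTransverse (lebesgueOnSpan fun i => (b i : V)) B

end Prevalence

/-! ### Submanifolds and transversality -/

section Manifolds

variable {E : Type*} [NormedAddCommGroup E] [NormedSpace ℝ E]
variable {G : Type*} [NormedAddCommGroup G] [NormedSpace ℝ G]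

/-- `φ` is a `C^r` diffeomorphism from an open neighbourhood `φ.source` of `x` onto an open set
`φ.target` in `ℝ^d × ℝ^c` such that `φ (M ∩ φ.source) = (ℝ^d × {0}) ∩ φ.target`. -/
structure IsSliceChart (r : ℕ∞) (d c : ℕ) (M : Set G) (x : G)
    (φ : OpenPartialHomeomorph G (EuclideanSpace ℝ (Fin d) × EuclideanSpace ℝ (Fin c))) :
    Prop where
  mem_source : x ∈ φ.source
  contDiffOn : ContDiffOn ℝ r φ φ.source
  contDiffOn_symm : ContDiffOn ℝ r φ.symm φ.target
  mem_iff : ∀ y ∈ φ.source, y ∈ M ↔ (φ y).2 = 0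

/-- `M` is a `C^r` (sub)manifold of dimension `d` and codimension `c`. -/
def IsCManifold (r : ℕ∞) (d c : ℕ) (M : Set G) : Prop :=
  ∀ x ∈ M, ∃ φ, IsSliceChart r d c M x φ

/-- The inverse image of `ℝ^d × {0}` under `Dφ(x)`. -/
noncomputable def chartTangent {d c : ℕ}
    (φ : OpenPartialHomeomorph G (EuclideanSpace ℝ (Fin d) × EuclideanSpace ℝ (Fin c))) (x : G) :
    Submodule ℝ G :=
  LinearMap.ker
    ((ContinuousLinearMap.snd ℝ (EuclideanSpace ℝ (Fin d)) (EuclideanSpace ℝ (Fin c))).comp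
      (fderiv ℝ φ x)).toLinearMap

open Classical in
/-- The tangent space of `M` at `x`: the inverse image of `ℝ^d × {0}` under `Dφ(x)`, for a chart `φ`
of `M` at `x`. By `tangentSpaceAt_eq` below it does not depend on the choice of the chart. -/
noncomputable def tangentSpaceAt (r : ℕ∞) (d c : ℕ) (M : Set G) (x : G) : Submodule ℝ G :=
  if h : ∃ φ, IsSliceChart r d c M x φ then chartTangent h.choose x else ⊥

theorem chartTangent_le {r : ℕ∞} {d c : ℕ} {M : Set G} {x : G} (hr : 1 ≤ r) (hx : x ∈ M)
    {φ ψ : OpenPartialHomeomorph G (EuclideanSpace ℝ (Fin d) × EuclideanSpace ℝ (Fin c))}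
    (hφ : IsSliceChart r d c M x φ) (hψ : IsSliceChart r d c M x ψ) :
    chartTangent φ x ≤ chartTangent ψ x := by
  have hr0 : ((r : ℕ∞) : WithTop ℕ∞) ≠ 0 := by
    have : r ≠ 0 := by
      rintro rfl
      simp at hr
    exact_mod_cast this
  intro v hv
  have hv' : (fderiv ℝ φ x v).2 = 0 := hv
  have dφ : HasFDerivAt φ (fderiv ℝ φ x) x :=
    ((hφ.contDiffOn.contDiffAt (φ.open_source.mem_nhds hφ.mem_source)).differentiableAt
      hr0).hasFDerivAt
  have dψ : HasFDerivAt ψ (fderiv ℝ ψ x) x :=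
    ((hψ.contDiffOn.contDiffAt (ψ.open_source.mem_nhds hψ.mem_source)).differentiableAt
      hr0).hasFDerivAt
  have hxt : φ x ∈ φ.target := φ.map_source hφ.mem_source
  have dφs : HasFDerivAt φ.symm (fderiv ℝ φ.symm (φ x)) (φ x) :=
    ((hφ.contDiffOn_symm.contDiffAt (φ.open_target.mem_nhds hxt)).differentiableAt
      hr0).hasFDerivAt
  have hleft : φ.symm (φ x) = x := φ.left_inv hφ.mem_source
  have hcomp : HasFDerivAt (fun y => φ.symm (φ y))
      ((fderiv ℝ φ.symm (φ x)).comp (fderiv ℝ φ x)) x := dφs.comp x dφ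
  have hid : HasFDerivAt (fun y => φ.symm (φ y)) (ContinuousLinearMap.id ℝ G) x := by
    refine (hasFDerivAt_id x).congr_of_eventuallyEq ?_
    filter_upwards [φ.open_source.mem_nhds hφ.mem_source] with y hy
    exact φ.left_inv hy
  have hinv : fderiv ℝ φ.symm (φ x) (fderiv ℝ φ x v) = v := by
    have := congrArg (fun L : G →L[ℝ] G => L v) (hcomp.unique hid)
    simpa using this
  have dline : HasDerivAt (fun t : ℝ => φ x + t • fderiv ℝ φ x v) (fderiv ℝ φ x v) 0 := by
    simpa using ((hasDerivAt_id (0 : ℝ)).smul_const (fderiv ℝ φ x v)).const_add (φ x)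
  have hl0 : φ x + (0 : ℝ) • fderiv ℝ φ x v = φ x := by simp
  have dγ : HasDerivAt (fun t : ℝ => φ.symm (φ x + t • fderiv ℝ φ x v)) v 0 := by
    have h := HasFDerivAt.comp_hasDerivAt (0 : ℝ) (l := φ.symm)
      (l' := fderiv ℝ φ.symm (φ x)) (by rw [hl0]; exact dφs) dline
    rw [hinv] at h
    exact h
  have hγ0 : φ.symm (φ x + (0 : ℝ) • fderiv ℝ φ x v) = x := by simpa using hleft
  have dψγ : HasDerivAt (fun t : ℝ => ψ (φ.symm (φ x + t • fderiv ℝ φ x v)))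
      (fderiv ℝ ψ x v) 0 :=
    HasFDerivAt.comp_hasDerivAt (0 : ℝ) (l := ψ) (l' := fderiv ℝ ψ x)
      (f := fun t : ℝ => φ.symm (φ x + t • fderiv ℝ φ x v)) (by rw [hγ0]; exact dψ) dγ
  have dsnd : HasDerivAt (fun t : ℝ => (ψ (φ.symm (φ x + t • fderiv ℝ φ x v))).2)
      (fderiv ℝ ψ x v).2 0 :=
    (ContinuousLinearMap.snd ℝ (EuclideanSpace ℝ (Fin d))
      (EuclideanSpace ℝ (Fin c))).hasFDerivAt.comp_hasDerivAt (0 : ℝ) dψγ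
  have hx2 : (φ x).2 = 0 := (hφ.mem_iff x hφ.mem_source).1 hx
  have hev : (fun t : ℝ => (ψ (φ.symm (φ x + t • fderiv ℝ φ x v))).2) =ᶠ[𝓝 0] fun _ => 0 := by
    have h1 : ∀ᶠ t : ℝ in 𝓝 0, φ x + t • fderiv ℝ φ x v ∈ φ.target :=
      dline.continuousAt.eventually_mem (φ.open_target.mem_nhds (by simpa using hxt))
    have h2 : ∀ᶠ t : ℝ in 𝓝 0, φ.symm (φ x + t • fderiv ℝ φ x v) ∈ ψ.source :=
      dγ.continuousAt.eventually_mem (ψ.open_source.mem_nhds (by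
        rw [hγ0]; exact hψ.mem_source))
    filter_upwards [h1, h2] with t ht1 ht2
    refine (hψ.mem_iff _ ht2).1 ((hφ.mem_iff _ (φ.map_target ht1)).2 ?_)
    rw [φ.right_inv ht1]
    simp [hx2, hv']
  have : (fderiv ℝ ψ x v).2 = 0 :=
    dsnd.unique ((hasDerivAt_const (0 : ℝ) (0 : EuclideanSpace ℝ (Fin c))).congr_of_eventuallyEq
      hev)
  exact this

theorem tangentSpaceAt_eq {r : ℕ∞} {d c : ℕ} {M : Set G} {x : G} (hr : 1 ≤ r) (hx : x ∈ M)
    {φ : OpenPartialHomeomorph G (EuclideanSpace ℝ (Fin d) × EuclideanSpace ℝ (Fin c))}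
    (hφ : IsSliceChart r d c M x φ) : tangentSpaceAt r d c M x = chartTangent φ x := by
  have h : ∃ φ, IsSliceChart r d c M x φ := ⟨φ, hφ⟩
  rw [tangentSpaceAt, dif_pos h]
  exact le_antisymm (chartTangent_le hr hx h.choose_spec hφ)
    (chartTangent_le hr hx hφ h.choose_spec)

/-- `F` is a `C^1` function on the open set `A` that is transversal to the `C^r` manifold `M` of
dimension `d` and codimension `c`: if `x ∈ A` and `F x ∈ M`, then the range of `DF(x)` and the
tangent space of `M` at `F x` span the whole space. -/
def IsTransversalOn (r : ℕ∞) (d c : ℕ) (F : E → G) (A : Opens E) (M : Set G) : Prop :=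
  ContDiffOn ℝ 1 F A ∧
    ∀ x ∈ A, F x ∈ M →
      LinearMap.range (fderiv ℝ F x).toLinearMap ⊔ tangentSpaceAt r d c M (F x) = ⊤

end Manifolds

/-! ### Jets, and the space of `C^l` functions -/

section Functions

variable (E : Type*) [NormedAddCommGroup E] [NormedSpace ℝ E]
variable (F : Type*) [NormedAddCommGroup F] [NormedSpace ℝ F]

/-- The space of symmetric `i`-linear maps from `E^i` to `F`. -/
def symMultilinear (i : ℕ) : Submodule ℝ (E [×i]→L[ℝ] F) where
  carrier := {q | ∀ (σ : Equiv.Perm (Fin i)) (v : Fin i → E), q (v ∘ σ) = q v}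
  add_mem' hp hq σ v := by simp [hp σ v, hq σ v]
  zero_mem' σ v := by simp
  smul_mem' a q hq σ v := by simp [hq σ v]

/-- The space `P^k(E, F)` of the polynomials of degree at most `k` from `E` to `F`, a polynomial `p`
being represented by its derivatives `(p(x), Dp(x), …, D^k p(x))` at a base point `x`. -/
def JetFiber (k : ℕ) : Type _ := (i : Fin (k + 1)) → symMultilinear E F i

noncomputable instance (k : ℕ) : NormedAddCommGroup (JetFiber E F k) :=
  inferInstanceAs (NormedAddCommGroup ((i : Fin (k + 1)) → symMultilinear E F i))

noncomputable instance (k : ℕ) : NormedSpace ℝ (JetFiber E F k) :=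
  inferInstanceAs (NormedSpace ℝ ((i : Fin (k + 1)) → symMultilinear E F i))

/-- The jet space `J^k(E, F) = E × P^k(E, F)`. -/
abbrev Jet (k : ℕ) : Type _ := E × JetFiber E F k

variable {E F}

open Classical in
/-- The `k`-jet `j^k f(x) = (x, f(x), Df(x), …, D^k f(x))`. Where `f` is `C^k` all these derivatives
are symmetric, see `coe_jet_snd`; the value `0` below is for other functions only. -/
noncomputable def jet (k : ℕ) (f : E → F) (x : E) : Jet E F k :=
  (x, fun i => if h : iteratedFDeriv ℝ i f x ∈ symMultilinear E F i
    then ⟨iteratedFDeriv ℝ i f x, h⟩ else 0)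

/-- The `i`-th derivative of a `C^i` function is symmetric. -/
theorem iteratedFDeriv_symm {f : E → F} (i : ℕ) : ∀ {x : E}, ContDiffAt ℝ i f x →
    ∀ (σ : Equiv.Perm (Fin i)) (v : Fin i → E),
      iteratedFDeriv ℝ i f x (v ∘ σ) = iteratedFDeriv ℝ i f x v := by
  induction i with
  | zero => intro x _ σ v; simp
  | succ i ih =>
    intro x hf σ
    have hev : ∀ᶠ y in 𝓝 x, ContDiffAt ℝ ((i + 1 : ℕ) : WithTop ℕ∞) f y := hf.eventually (by simp)
    have hd : ∀ y, ContDiffAt ℝ ((i + 1 : ℕ) : WithTop ℕ∞) f y →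
        DifferentiableAt ℝ (iteratedFDeriv ℝ i f) y := fun y hy =>
      hy.differentiableAt_iteratedFDeriv (by exact_mod_cast Nat.lt_succ_self i)
    have hσ : σ ∈ Submonoid.closure
        (Set.range fun j : Fin i => Equiv.swap j.castSucc j.succ) := by
      rw [Equiv.Perm.mclosure_swap_castSucc_succ]; trivial
    induction hσ using Submonoid.closure_induction with
    | one => intro v; rfl
    | mul a b _ _ ha hb =>
      intro v
      rw [Equiv.Perm.coe_mul, ← Function.comp_assoc, hb, ha]
    | mem a ha =>
      obtain ⟨j, rfl⟩ := ha
      intro v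
      cases i with
      | zero => exact j.elim0
      | succ i =>
      induction j using Fin.cases with
      | zero =>
        have hg : ContDiffAt ℝ 2 (fun z => iteratedFDeriv ℝ i f z fun a => v a.succ.succ) x := by
          have h1 : ContDiffAt ℝ 2 (iteratedFDeriv ℝ i f) x :=
            hf.iteratedFDeriv_right (by push_cast; rw [add_comm, add_assoc]; norm_num)
          exact (ContinuousMultilinearMap.apply ℝ (fun _ : Fin i => E) F
            (fun a => v a.succ.succ)).contDiff.contDiffAt.comp x h1
        have key : ∀ w : Fin (i + 1 + 1) → E, (∀ a : Fin i, w a.succ.succ = v a.succ.succ) →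
            iteratedFDeriv ℝ (i + 1 + 1) f x w =
              fderiv ℝ (fderiv ℝ (fun z => iteratedFDeriv ℝ i f z fun a => v a.succ.succ)) x
                (w 0) (w 1) := by
          intro w hw
          rw [(hd x hf).iteratedFDeriv_succ_apply_left']
          have he : (fun y => iteratedFDeriv ℝ (i + 1) f y (Fin.tail w)) =ᶠ[𝓝 x] fun y =>
              fderiv ℝ (fun z => iteratedFDeriv ℝ i f z fun a => v a.succ.succ) y (w 1) := by
            filter_upwards [hev] with y hy
            have : DifferentiableAt ℝ (iteratedFDeriv ℝ i f) y :=
              hy.differentiableAt_iteratedFDeriv (by exact_mod_cast (by omega : i < i + 1 + 1))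
            rw [this.iteratedFDeriv_succ_apply_left']
            have : Fin.tail (Fin.tail w) = fun a => v a.succ.succ := funext hw
            rw [this]
            rfl
          rw [he.fderiv_eq]
          have hdd : DifferentiableAt ℝ
              (fderiv ℝ (fun z => iteratedFDeriv ℝ i f z fun a => v a.succ.succ)) x :=
            (hg.fderiv_right (m := 1) (by norm_num)).differentiableAt (by norm_num)
          rw [fderiv_clm_apply hdd (differentiableAt_const _)]
          simp
        rw [key v fun _ => rfl, key (v ∘ Equiv.swap _ _)]
        · have hs := (hg.isSymmSndFDerivAt (by simp)).eq (v 1) (v 0)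
          simpa using hs
        · intro a
          simp only [Function.comp]
          rw [Equiv.swap_apply_of_ne_of_ne]
          · simp [Fin.ext_iff]
          · simp [Fin.ext_iff]
      | succ j =>
        rw [(hd x hf).iteratedFDeriv_succ_apply_left', (hd x hf).iteratedFDeriv_succ_apply_left']
        have h0 : (v ∘ Equiv.swap j.succ.castSucc j.succ.succ) 0 = v 0 := by
          simp only [Function.comp]
          rw [Equiv.swap_apply_of_ne_of_ne]
          · simp [Fin.ext_iff]
          · simp [Fin.ext_iff]
        have ht : Fin.tail (v ∘ Equiv.swap j.succ.castSucc j.succ.succ) =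
            Fin.tail v ∘ Equiv.swap j.castSucc j.succ := by
          funext a
          simp only [Fin.tail, Function.comp]
          congr 1
          rw [← Fin.succ_castSucc]
          exact ((Fin.succ_injective _).swap_apply _ _ _)
        rw [h0, ht]
        congr 1
        apply Filter.EventuallyEq.fderiv_eq
        filter_upwards [hev] with y hy
        exact ih (hy.of_le (by exact_mod_cast Nat.le_succ _)) _ _

theorem coe_jet_snd {k : ℕ} {f : E → F} {x : E} (hf : ContDiffAt ℝ k f x) (i : Fin (k + 1)) :
    ((jet k f x).2 i : E [×i]→L[ℝ] F) = iteratedFDeriv ℝ i f x := by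
  have hi : ((i : ℕ) : WithTop ℕ∞) ≤ k := by
    exact_mod_cast Nat.lt_succ_iff.1 i.2
  have h : iteratedFDeriv ℝ i f x ∈ symMultilinear E F i :=
    iteratedFDeriv_symm i (hf.of_le hi)
  simp only [jet, dif_pos h]

variable (F)

/-- The vector space of the `C^l` functions from the open set `A` to `F`. A function on `A` is
represented by its extension by zero to the whole space. -/
def cFunSubmodule (l : ℕ∞) (A : Opens E) : Submodule ℝ (E → F) where
  carrier := {f | ContDiffOn ℝ l f A ∧ ∀ x ∉ A, f x = 0}
  add_mem' hf hg := ⟨hf.1.add hg.1, fun x hx => by simp [hf.2 x hx, hg.2 x hx]⟩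
  zero_mem' := ⟨contDiffOn_const, fun _ _ => rfl⟩
  smul_mem' a f hf := ⟨contDiffOn_const.smul hf.1, fun x hx => by simp [hf.2 x hx]⟩

/-- The type of the `C^l` functions from the open set `A` to `F`. -/
def CFun (l : ℕ∞) (A : Opens E) : Type _ := cFunSubmodule F l A

variable {F}

namespace CFun

variable {l : ℕ∞} {A : Opens E}

noncomputable instance : AddCommGroup (CFun F l A) :=
  inferInstanceAs (AddCommGroup (cFunSubmodule F l A))

noncomputable instance : Module ℝ (CFun F l A) :=
  inferInstanceAs (Module ℝ (cFunSubmodule F l A))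

instance : CoeFun (CFun F l A) fun _ => E → F := ⟨fun f => f.1⟩

/-- The `C^l` topology: uniform convergence on the compact subsets of `A` of all derivatives of
(finite) order at most `l`. -/
noncomputable instance : TopologicalSpace (CFun F l A) :=
  ⨅ (i : ℕ) (_ : (i : ℕ∞) ≤ l),
    TopologicalSpace.induced
      (fun f : CFun F l A =>
        UniformOnFun.ofFun {K : Set E | IsCompact K ∧ K ⊆ A} (iteratedFDeriv ℝ i (f : E → F)))
      inferInstance

noncomputable instance : MeasurableSpace (CFun F l A) := borel _

instance : BorelSpace (CFun F l A) := ⟨rfl⟩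

end CFun

variable (F)

/-- The subspace of `C^l(A, F)` of the polynomials of degree at most `k`: the functions
`x ↦ q_0 + q_1(x) + q_2(x, x) + ⋯ + q_k(x, …, x)` with `q_i` an `i`-linear map. -/
def polynomials (l : ℕ∞) (A : Opens E) (k : ℕ) : Submodule ℝ (CFun F l A) where
  carrier := {f | ∃ q : (i : Fin (k + 1)) → E [×i]→L[ℝ] F,
    ∀ x ∈ A, (f : E → F) x = ∑ i, q i fun _ => x}
  add_mem' := by
    rintro f g ⟨p, hp⟩ ⟨q, hq⟩
    refine ⟨p + q, fun x hx => ?_⟩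
    change f x + g x = _
    simp [hp x hx, hq x hx, Finset.sum_add_distrib]
  zero_mem' := ⟨0, fun x _ => by
    change (0 : F) = _
    simp⟩
  smul_mem' := by
    rintro a f ⟨p, hp⟩
    refine ⟨a • p, fun x hx => ?_⟩
    change a • f x = _
    simp [hp x hx, Finset.smul_sum]

end Functions

end JetTransversality

/-! Fix `f`, and for a jet `z` over a base point `x` let T(z) be the unique polynomial p of degree ≤
k for which f + p has jet `z` at `x` (`jetDiff`). It exists because a polynomial of degree ≤ k is
determined by its jet at any one point (`jetShift_injective`), and T loses only k derivatives
against `f`. Over `A`, the image of j^k(f + p) is exactly the fibre of T over p, and its tangent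
space is ker DT. Hence j^k(f + p) is transversal to Z at `z` as soon as DT maps T_zZ onto the space
P^k of polynomials. The bad p are therefore critical values of T restricted to Z, and Sard's theorem
makes them a null set (`volume_not_transversal_eq_zero`). If N = dim P^k, then dim Z = n + N - c, so
Sard needs class C^s with s ≥ 1 and s > n - c; this is what the bounds on r and l provide.

Sard's theorem in this sharp form (`volume_image_not_surjective_fderiv`) is proved by induction on
the dimension of the target. Where Df ≠ 0, a component of f becomes a coordinate, and Fubini reduces
to its level sets. Where Df = 0, Morse's lemma (`isMorseCovered_self`) covers the critical set by
countably many C^1 images along which C^s functions vanishing on the set are o(dist^s). Applied to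
Df and integrated, this makes f vary so little that a Hölder estimate for Hausdorff measure gives a
null image.

For the probe property the bad functions must also lie in a Borel set: failure of transversality
over a compact ball, at jets in a closed piece of a chart, is a closed condition on the function
(`isClosed_nonTransversalSet`), and countably many such pairs suffice. -/

namespace JetTransversality

open Set Topology MeasureTheory TopologicalSpace
open scoped ENNReal

/-! ### Local charts with a prescribed first coordinate. -/

section Straightening

variable {E : Type*} [NormedAddCommGroup E] [NormedSpace ℝ E] [FiniteDimensional ℝ E]

/-- A function with nonzero derivative at a point is the first coordinate of a local chart. -/
theorem exists_straightening {s : ℕ} (hs : 1 ≤ s) {w : E → ℝ} {x₀ : E} (hw : ContDiffAt ℝ s w x₀)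
    (hw0 : fderiv ℝ w x₀ ≠ 0) {U : Set E} (hU : U ∈ 𝓝 x₀) :
    ∃ (H : Submodule ℝ E) (Ψ : OpenPartialHomeomorph E (ℝ × H)),
      Module.finrank ℝ H + 1 = Module.finrank ℝ E ∧ x₀ ∈ Ψ.source ∧ Ψ.source ⊆ U ∧
      (∀ x ∈ Ψ.source, (Ψ x).1 = w x) ∧ (∀ z ∈ Ψ.target, ContDiffAt ℝ s Ψ.symm z) := by
  have hs0 : (s : WithTop ℕ∞) ≠ 0 := by exact_mod_cast (by omega : s ≠ 0)
  obtain ⟨L, hL⟩ : ∃ L : E →L[ℝ] ℝ, L = fderiv ℝ w x₀ := ⟨_, rfl⟩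
  have hLs : Function.Surjective L :=
    LinearMap.surjective (f := L.toLinearMap)
      (fun h => hw0 (hL ▸ ContinuousLinearMap.coe_injective h))
  have hdim : Module.finrank ℝ (LinearMap.ker L.toLinearMap) + 1 = Module.finrank ℝ E := by
    have h1 := L.toLinearMap.finrank_range_add_finrank_ker
    rw [LinearMap.range_eq_top.2 hLs, finrank_top, Module.finrank_self] at h1
    omega
  obtain ⟨π, hπ⟩ := L.ker_closedComplemented_of_finiteDimensional_range
  have hinj : Function.Injective (L.prod π).toLinearMap := by
    rw [← LinearMap.ker_eq_bot, LinearMap.ker_eq_bot']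
    intro x hx
    have h1 : L x = 0 := congrArg Prod.fst hx
    have h2 : π x = 0 := congrArg Prod.snd hx
    have h3 := hπ ⟨x, h1⟩
    rw [h2] at h3
    exact (congrArg Subtype.val h3).symm
  let Λ : E ≃L[ℝ] ℝ × LinearMap.ker L.toLinearMap :=
    (LinearEquiv.ofInjectiveOfFinrankEq (L.prod π).toLinearMap hinj (by
      rw [Module.finrank_prod, Module.finrank_self, ← hdim, add_comm])).toContinuousLinearEquiv
  have hf : ContDiffAt ℝ s (fun x => (w x, π x)) x₀ := hw.prodMk π.contDiff.contDiffAt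
  have hf' : HasFDerivAt (fun x => (w x, π x))
      (Λ : E →L[ℝ] ℝ × LinearMap.ker L.toLinearMap) x₀ := by
    have h := (hw.differentiableAt hs0).hasFDerivAt.prodMk (π.hasFDerivAt (x := x₀))
    rw [← hL] at h
    exact h
  set Φ := hf.toOpenPartialHomeomorph _ hf' hs0 with hΦ
  have hx₀ : x₀ ∈ Φ.source := hf.mem_toOpenPartialHomeomorph_source hf' hs0
  have hsymm : ContDiffAt ℝ s Φ.symm (Φ x₀) := hf.to_localInverse hf' hs0
  -- Being C^s at a point, for finite `s`, is an open condition; the chart is shrunk until its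
  -- inverse is C^s on the whole target.
  obtain ⟨V, hV, hVo, hxV⟩ := mem_nhds_iff.1 (hsymm.eventually (by simp))
  set O := interior U ∩ (Φ.source ∩ Φ ⁻¹' V) with hO
  have hOo : IsOpen O := isOpen_interior.inter (Φ.isOpen_inter_preimage hVo)
  refine ⟨_, Φ.restrOpen O hOo, hdim, ?_, ?_, ?_, ?_⟩
  · exact ⟨hx₀, mem_interior_iff_mem_nhds.2 hU, hx₀, hxV⟩
  · rintro x ⟨-, hx, -⟩
    exact interior_subset hx
  · intro x _
    rfl
  · rintro z ⟨hz, hzO⟩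
    have h1 : Φ (Φ.symm z) ∈ V := hzO.2.2
    rw [Φ.right_inv hz] at h1
    exact hV h1

end Straightening

/-! ### Morse's lemma on functions vanishing on an arbitrary set. -/

section MorsePieces

open Asymptotics

/-- Integration of a pointwise asymptotic bound on the derivative of `f` along a `C^1` map. -/
theorem isLittleO_comp_sub_of_fderiv {X E F : Type*} [NormedAddCommGroup X] [NormedSpace ℝ X]
    [NormedAddCommGroup E] [NormedSpace ℝ E] [NormedAddCommGroup F] [NormedSpace ℝ F]
    {ψ : X → E} {f : E → F} {b : X} {s : ℕ} (hψ : ContDiffAt ℝ 1 ψ b) (hf : ContDiffAt ℝ 1 f (ψ b))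
    (h : (fun y => fderiv ℝ f (ψ y)) =o[𝓝 b] fun y => ‖y - b‖ ^ s) :
    (fun y => f (ψ y) - f (ψ b)) =o[𝓝 b] fun y => ‖y - b‖ ^ (s + 1) := by
  have h1 : (1 : WithTop ℕ∞) ≠ 0 := one_ne_zero
  have hψd : ∀ᶠ y in 𝓝 b, DifferentiableAt ℝ ψ y :=
    (hψ.eventually (by simp)).mono fun y hy => hy.differentiableAt h1
  have hfd : ∀ᶠ y in 𝓝 b, DifferentiableAt ℝ f (ψ y) :=
    (hψ.continuousAt.eventually (hf.eventually (by simp))).mono fun y hy => hy.differentiableAt h1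
  have hψb : (fun y => fderiv ℝ ψ y) =O[𝓝 b] fun _ => (1 : ℝ) :=
    ((hψ.fderiv_right (m := 0) (by simp)).continuousAt).isBigO_one ℝ
  have hD : (fun y => (fderiv ℝ f (ψ y)).comp (fderiv ℝ ψ y)) =o[𝓝 b] fun y => ‖y - b‖ ^ s := by
    have h2 : (fun y => (fderiv ℝ f (ψ y)).comp (fderiv ℝ ψ y)) =O[𝓝 b]
        fun y => ‖fderiv ℝ f (ψ y)‖ * ‖fderiv ℝ ψ y‖ :=
      IsBigO.of_norm_le fun y => by
        exact (ContinuousLinearMap.opNorm_comp_le _ _)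
    refine h2.trans_isLittleO ?_
    simpa using h.norm_left.mul_isBigO hψb.norm_left
  rw [isLittleO_iff] at hD ⊢
  intro ε hε
  obtain ⟨δ, hδ, hball⟩ := Metric.eventually_nhds_iff_ball.1 ((hD hε).and (hψd.and hfd))
  filter_upwards [Metric.ball_mem_nhds b hδ] with y hy
  -- On this ball the derivative of the composite is at most `ε * ‖y - b‖ ^ s`; the mean value
  -- inequality supplies the missing factor `‖y - b‖`.
  have hsub : Metric.closedBall b ‖y - b‖ ⊆ Metric.ball b δ :=
    Metric.closedBall_subset_ball (by rwa [← dist_eq_norm])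
  have hmv := (convex_closedBall b ‖y - b‖).norm_image_sub_le_of_norm_hasFDerivWithin_le
    (f := fun y => f (ψ y)) (f' := fun y => (fderiv ℝ f (ψ y)).comp (fderiv ℝ ψ y))
    (C := ε * ‖y - b‖ ^ s) (x := b) (y := y)
    (fun z hz => ((hball z (hsub hz)).2.2.hasFDerivAt.comp z
      (hball z (hsub hz)).2.1.hasFDerivAt).hasFDerivWithinAt)
    (fun z hz => by
      refine (hball z (hsub hz)).1.trans ?_
      rw [norm_pow, norm_norm]
      have : ‖z - b‖ ≤ ‖y - b‖ := by simpa [dist_eq_norm] using hz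
      gcongr)
    (by simp) (by simp [dist_eq_norm])
  rw [norm_pow, norm_norm, pow_succ, ← mul_assoc]
  exact hmv

variable {E : Type} [NormedAddCommGroup E] [NormedSpace ℝ E]

/-- `S` is the image of a set of parameters under a map that is `C^1` there, such that all
`C^s` functions vanishing on `A` vanish to order more than `s` at these parameters. -/
def IsMorsePiece (s : ℕ) (A S : Set E) : Prop :=
  ∃ (p : ℕ) (ψ : (Fin p → ℝ) → E) (B : Set (Fin p → ℝ)), p ≤ Module.finrank ℝ E ∧ S ⊆ ψ '' B ∧
    ∀ b ∈ B, ψ b ∈ A ∧ ContDiffAt ℝ 1 ψ b ∧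
      -- All targets are needed at once: the induction on `s` passes from `g` to `fderiv ℝ g`, whose
      -- values lie in another space.
      ∀ (F : Type) [NormedAddCommGroup F] [NormedSpace ℝ F] (g : E → F),
        (∀ a ∈ A, ContDiffAt ℝ s g a) → (∀ a ∈ A, g a = 0) →
          (fun y => g (ψ y)) =o[𝓝 b] fun y => ‖y - b‖ ^ s

/-- `S` is covered by countably many Morse pieces. -/
def IsMorseCovered (s : ℕ) (A S : Set E) : Prop :=
  ∃ C : Set (Set E), C.Countable ∧ S ⊆ ⋃₀ C ∧ ∀ T ∈ C, IsMorsePiece s A T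

theorem IsMorseCovered.mono {s : ℕ} {A S T : Set E} (h : IsMorseCovered s A T) (hST : S ⊆ T) :
    IsMorseCovered s A S := by
  obtain ⟨C, h1, h2, h3⟩ := h
  exact ⟨C, h1, hST.trans h2, h3⟩

theorem IsMorseCovered.iUnion {s : ℕ} {A : Set E} {ι : Type*} [Countable ι] {S : ι → Set E}
    (h : ∀ i, IsMorseCovered s A (S i)) : IsMorseCovered s A (⋃ i, S i) := by
  choose C h1 h2 h3 using h
  refine ⟨⋃ i, C i, countable_iUnion h1, ?_, ?_⟩
  · rw [sUnion_iUnion]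
    exact iUnion_mono h2
  · intro T hT
    obtain ⟨i, hi⟩ := mem_iUnion.1 hT
    exact h3 i T hi

theorem IsMorseCovered.union {s : ℕ} {A S T : Set E} (hS : IsMorseCovered s A S)
    (hT : IsMorseCovered s A T) : IsMorseCovered s A (S ∪ T) := by
  rw [union_eq_iUnion]
  exact IsMorseCovered.iUnion fun b => by cases b <;> assumption

theorem IsMorseCovered.of_nhds [FiniteDimensional ℝ E] {s : ℕ} {A S : Set E}
    (h : ∀ x ∈ S, ∃ O ∈ 𝓝 x, IsMorseCovered s A (S ∩ O)) : IsMorseCovered s A S := by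
  choose! O hO h using h
  have : ProperSpace E := FiniteDimensional.proper_real E
  obtain ⟨t, htS, htc, ht⟩ := countable_cover_nhdsWithin (s := S) (f := O)
    fun x hx => mem_nhdsWithin_of_mem_nhds (hO x hx)
  have := htc.to_subtype
  refine (IsMorseCovered.iUnion (ι := t) fun i => h i (htS i.2)).mono fun x hx => ?_
  obtain ⟨i, hi, hxi⟩ := mem_iUnion₂.1 (ht hx)
  exact mem_iUnion.2 ⟨⟨i, hi⟩, hx, hxi⟩

theorem IsMorsePiece.zero [FiniteDimensional ℝ E] (A : Set E) : IsMorsePiece 0 A A := by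
  have e : (Fin (Module.finrank ℝ E) → ℝ) ≃L[ℝ] E :=
    ContinuousLinearEquiv.ofFinrankEq (by simp)
  refine ⟨_, e, e ⁻¹' A, le_rfl, fun x hx => ⟨e.symm x, by simpa using hx, by simp⟩, ?_⟩
  refine fun b hb => ⟨hb, e.contDiff.contDiffAt, fun F _ _ g hg hg0 => ?_⟩
  simp only [pow_zero]
  rw [isLittleO_one_iff]
  have h : Filter.Tendsto (fun y => g (e y)) (𝓝 b) (𝓝 (g (e b))) :=
    ((hg _ hb).continuousAt.comp e.continuous.continuousAt).tendsto
  rwa [hg0 _ hb] at h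

/-- A Morse piece of order `s` for a set on which the derivatives of the functions vanish. -/
theorem IsMorsePiece.succ {s : ℕ} {A A' S : Set E} (hA : A' ⊆ A)
    (hA' : ∀ (F : Type) [NormedAddCommGroup F] [NormedSpace ℝ F] (g : E → F),
        (∀ a ∈ A, ContDiffAt ℝ (s + 1 : ℕ) g a) → (∀ a ∈ A, g a = 0) → ∀ a ∈ A', fderiv ℝ g a = 0)
    (h : IsMorsePiece s A' S) : IsMorsePiece (s + 1) A S := by
  obtain ⟨p, ψ, B, hp, hS, hB⟩ := h
  refine ⟨p, ψ, B, hp, hS, fun b hb => ?_⟩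
  obtain ⟨h1, h2, h3⟩ := hB b hb
  refine ⟨hA h1, h2, fun F _ _ g hg hg0 => ?_⟩
  have h4 := h3 (E →L[ℝ] F) (fderiv ℝ g)
    (fun a ha => (hg a (hA ha)).fderiv_right (by push_cast; rfl)) (hA' F g hg hg0)
  have h5 := isLittleO_comp_sub_of_fderiv h2
    ((hg _ (hA h1)).of_le (by exact_mod_cast Nat.le_add_left 1 s)) h4
  simpa [hg0 _ (hA h1)] using h5

/-- Transport of Morse pieces along a map of a space of smaller dimension. -/
theorem IsMorsePiece.image {E' : Type} [NormedAddCommGroup E'] [NormedSpace ℝ E'] {s : ℕ}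
    (hs : 1 ≤ s) (hE : Module.finrank ℝ E' ≤ Module.finrank ℝ E) {A : Set E} {A' S : Set E'}
    {θ : E' → E} (hA : ∀ a ∈ A', θ a ∈ A) (hθ : ∀ a ∈ A', ContDiffAt ℝ s θ a)
    (h : IsMorsePiece s A' S) : IsMorsePiece s A (θ '' S) := by
  obtain ⟨p, ψ, B, hp, hS, hB⟩ := h
  refine ⟨p, θ ∘ ψ, B, hp.trans hE, ?_, fun b hb => ?_⟩
  · rw [image_comp]
    exact image_mono hS
  obtain ⟨h1, h2, h3⟩ := hB b hb
  refine ⟨hA _ h1, ((hθ _ h1).of_le (by exact_mod_cast hs)).comp b h2, fun F _ _ g hg hg0 => ?_⟩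
  exact h3 F (g ∘ θ) (fun a ha => (hg _ (hA a ha)).comp a (hθ a ha)) fun a ha => hg0 _ (hA a ha)

/-- Each point of `A` allows a gain. Either `A` lies near it in a hypersurface, and the dimension
drops, or all derivatives of functions vanishing on `A` vanish there, and integrating them raises
the order by one. -/
theorem isMorseCovered_self (s : ℕ) : ∀ (p : ℕ) (E : Type) [NormedAddCommGroup E]
    [NormedSpace ℝ E] [FiniteDimensional ℝ E] (A : Set E), Module.finrank ℝ E = p →
      IsMorseCovered s A A := by
  induction s with
  | zero =>
    intro p E _ _ _ A _
    exact ⟨{A}, countable_singleton A, by simp, by simpa using IsMorsePiece.zero A⟩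
  | succ s ihs =>
  intro p
  induction p with
  | zero =>
    intro E _ _ _ A hE
    have hsub : Subsingleton E := Module.finrank_zero_iff.1 hE
    obtain ⟨C, h1, h2, h3⟩ := ihs 0 E A hE
    exact ⟨C, h1, h2, fun T hT => (h3 T hT).succ Subset.rfl fun F _ _ g _ _ a _ => by
      ext v
      rw [Subsingleton.elim v 0]
      simp⟩
  | succ p ihp =>
  intro E _ _ _ A hE
  set A₁ : Set E := {x | x ∈ A ∧ ∃ w : E → ℝ, (∀ a ∈ A, ContDiffAt ℝ (s + 1 : ℕ) w a) ∧
    (∀ a ∈ A, w a = 0) ∧ fderiv ℝ w x ≠ 0} with hA₁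
  have hcov₁ : IsMorseCovered (s + 1) A A₁ := by
    refine IsMorseCovered.of_nhds ?_
    rintro x ⟨hx, w, hw, hw0, hwx⟩
    obtain ⟨H, Ψ, hdim, hxs, -, hfst, hsymm⟩ :=
      exists_straightening (Nat.le_add_left 1 s) (hw x hx) hwx Filter.univ_mem
    refine ⟨Ψ.source, Ψ.open_source.mem_nhds hxs, ?_⟩
    -- Since `w` vanishes on `A`, the chart puts the nearby points of `A` in the hyperplane of first
    -- coordinate 0, of dimension `p`.
    set A' : Set H := {y | ((0 : ℝ), y) ∈ Ψ.target ∧ Ψ.symm ((0 : ℝ), y) ∈ A} with hA'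
    obtain ⟨C, h1, h2, h3⟩ := ihp H A' (by omega)
    refine ⟨(fun T => (fun y : H => Ψ.symm ((0 : ℝ), y)) '' T) '' C, h1.image _, ?_, ?_⟩
    · rintro z ⟨⟨hzA, -⟩, hz⟩
      have h0 : Ψ z = ((0 : ℝ), (Ψ z).2) := by
        rw [Prod.ext_iff]
        exact ⟨(hfst z hz).trans (hw0 z hzA), rfl⟩
      have hz' : Ψ.symm ((0 : ℝ), (Ψ z).2) = z := by rw [← h0, Ψ.left_inv hz]
      have hmem : (Ψ z).2 ∈ A' := ⟨by rw [← h0]; exact Ψ.map_source hz, by rwa [hz']⟩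
      obtain ⟨T, hT, hzT⟩ := h2 hmem
      exact ⟨_, mem_image_of_mem _ hT, _, hzT, hz'⟩
    · rintro _ ⟨T, hT, rfl⟩
      refine (h3 T hT).image (Nat.le_add_left 1 s) (by omega) (fun a ha => ha.2) fun a ha => ?_
      exact (hsymm _ ha.1).comp a (contDiffAt_const.prodMk contDiffAt_id)
  have hcov₂ : IsMorseCovered (s + 1) A (A \ A₁) := by
    obtain ⟨C, h1, h2, h3⟩ := ihs (p + 1) E (A \ A₁) hE
    refine ⟨C, h1, h2, fun T hT => (h3 T hT).succ sdiff_subset fun F _ _ g hg hg0 a ha => ?_⟩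
    -- `A₁` is defined by real-valued functions only; a functional that does not kill a value of the
    -- derivative reduces `g` to that case.
    by_contra hne
    obtain ⟨v, hv⟩ : ∃ v, fderiv ℝ g a v ≠ 0 := by
      by_contra! hcon
      exact hne (ContinuousLinearMap.ext hcon)
    obtain ⟨φ, hφ⟩ := SeparatingDual.exists_ne_zero (R := ℝ) hv
    refine ha.2 ⟨ha.1, φ ∘ g, fun x hx => φ.contDiff.contDiffAt.comp x (hg x hx),
      fun x hx => by simp [hg0 x hx], fun h0 => hφ ?_⟩
    have hd : HasFDerivAt (φ ∘ g) (φ.comp (fderiv ℝ g a)) a :=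
      φ.hasFDerivAt.comp a ((hg a ha.1).differentiableAt
        (by exact_mod_cast Nat.succ_ne_zero s)).hasFDerivAt
    rw [hd.fderiv] at h0
    exact congrArg (fun L : E →L[ℝ] ℝ => L v) h0
  refine (hcov₁.union hcov₂).mono fun x hx => ?_
  by_cases h : x ∈ A₁
  · exact Or.inl h
  · exact Or.inr ⟨hx, h⟩

end MorsePieces

/-! ### Null images under maps of small variation. -/

section ImageNull

open Asymptotics

/-- On a piece of diameter less than `δ` the map is `s`-Hölder with constant `ε`, so the
q-dimensional Hausdorff measure of the image is at most `ε ^ q` times the sq-dimensional measure of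
the piece, hence also times its p-dimensional measure. In the sup norm these measures are Lebesgue
measure. The measurable set `V` stands in for `B`, which may fail to be measurable, so that the
bounds add up. -/
theorem volume_image_le_of_norm_sub_le {p q s : ℕ} (hs : 1 ≤ s) (hpq : p ≤ s * q)
    {h : (Fin p → ℝ) → Fin q → ℝ} {B V : Set (Fin p → ℝ)} (hBV : B ⊆ V) (hV : MeasurableSet V)
    {ε δ : ℝ} (hε : 0 ≤ ε) (hδ : 0 < δ)
    (hh : ∀ b ∈ B, ∀ y, ‖y - b‖ < δ → ‖h y - h b‖ ≤ ε * ‖y - b‖ ^ s) :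
    volume (h '' B) ≤ ENNReal.ofReal ε ^ q * volume V := by
  set P : ℕ → Set (Fin p → ℝ) :=
    disjointed fun n => Metric.ball (denseSeq (Fin p → ℝ) n) (δ / 2) with hP
  have hPm : ∀ n, MeasurableSet (P n) := fun n =>
    MeasurableSet.disjointed (fun _ => Metric.isOpen_ball.measurableSet) n
  have hPd : ∀ n, ∀ x ∈ P n, ∀ y ∈ P n, ‖x - y‖ < δ := by
    intro n x hx y hy
    have hx' := disjointed_subset _ n hx
    have hy' := disjointed_subset _ n hy
    rw [Metric.mem_ball] at hx' hy'
    rw [← dist_eq_norm]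
    linarith [dist_triangle_right x y (denseSeq (Fin p → ℝ) n)]
  have hPu : ⋃ n, P n = univ := by
    rw [hP, iUnion_disjointed, eq_univ_iff_forall]
    intro x
    obtain ⟨n, hn⟩ := (denseRange_denseSeq (Fin p → ℝ)).exists_dist_lt x (half_pos hδ)
    exact mem_iUnion.2 ⟨n, hn⟩
  have hq : (μH[(q : ℝ)] : Measure (Fin q → ℝ)) = volume := by
    simpa using hausdorffMeasure_pi_real (ι := Fin q)
  have hp : (μH[(p : ℝ)] : Measure (Fin p → ℝ)) = volume := by
    simpa using hausdorffMeasure_pi_real (ι := Fin p)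
  have hpiece : ∀ n, volume (h '' (B ∩ P n)) ≤ ENNReal.ofReal ε ^ q * volume (V ∩ P n) := by
    intro n
    have hH : HolderOnWith ε.toNNReal s h (B ∩ P n) := by
      intro x hx y hy
      have h1 := hh y hy.1 x (hPd n x hx.2 y hy.2)
      rw [edist_eq_enorm_sub, edist_eq_enorm_sub]
      simp only [NNReal.coe_natCast, ENNReal.rpow_natCast]
      rw [← ofReal_norm, ← ofReal_norm, ← ENNReal.ofReal_pow (norm_nonneg _)]
      change _ ≤ ENNReal.ofReal ε * _
      rw [← ENNReal.ofReal_mul hε]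
      exact ENNReal.ofReal_le_ofReal h1
    have h2 := hH.hausdorffMeasure_image_le (by exact_mod_cast hs) (Nat.cast_nonneg q)
    rw [hq, ENNReal.rpow_natCast] at h2
    refine h2.trans (mul_le_mul' le_rfl ?_)
    rw [← hp]
    exact (measure_mono (inter_subset_inter_left _ hBV)).trans
      (Measure.hausdorffMeasure_mono (by simpa using (by exact_mod_cast hpq)) _)
  calc volume (h '' B) = volume (⋃ n, h '' (B ∩ P n)) := by
        rw [← image_iUnion, ← inter_iUnion, hPu, inter_univ]
    _ ≤ ∑' n, volume (h '' (B ∩ P n)) := measure_iUnion_le _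
    _ ≤ ∑' n, ENNReal.ofReal ε ^ q * volume (V ∩ P n) := ENNReal.tsum_le_tsum hpiece
    _ = ENNReal.ofReal ε ^ q * volume V := by
        rw [ENNReal.tsum_mul_left, ← measure_iUnion, ← inter_iUnion, hPu, inter_univ]
        · intro i j hij
          exact ((disjoint_disjointed _ hij).inter_left' _).inter_right' _
        · exact fun n => hV.inter (hPm n)

/-- A map that varies less than the `s`-th power of the distance maps a set of dimension at most
`s * q` to a null set. -/
theorem volume_image_eq_zero_of_isLittleO {p q s : ℕ} (hs : 1 ≤ s) (hq : 1 ≤ q) (hpq : p ≤ s * q)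
    {h : (Fin p → ℝ) → Fin q → ℝ} {B : Set (Fin p → ℝ)}
    (hh : ∀ b ∈ B, (fun y => h y - h b) =o[𝓝 b] fun y => ‖y - b‖ ^ s) :
    volume (h '' B) = 0 := by
  have hbdd : ∀ R : ℕ, volume (h '' (B ∩ Metric.ball 0 R)) = 0 := by
    intro R
    set V : Set (Fin p → ℝ) := Metric.ball 0 R with hV
    have hle : ∀ ε : ℝ, 0 < ε → volume (h '' (B ∩ V)) ≤ ENNReal.ofReal ε ^ q * volume V := by
      intro ε hε
      -- The points where the bound holds with the uniform radius 1/(n + 1). These sets increase to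
      -- `B ∩ V`, and continuity from below of the measure holds for arbitrary sets.
      set D : ℕ → Set (Fin p → ℝ) := fun n =>
        {b | b ∈ B ∩ V ∧ ∀ y, ‖y - b‖ < 1 / (n + 1 : ℝ) → ‖h y - h b‖ ≤ ε * ‖y - b‖ ^ s} with hD
      have hmono : Monotone fun n => h '' D n := by
        intro i j hij
        refine image_mono fun b hb => ⟨hb.1, fun y hy => hb.2 y (hy.trans_le ?_)⟩
        gcongr
      have hun : h '' (B ∩ V) = ⋃ n, h '' D n := by
        rw [← image_iUnion]
        congr 1
        ext b
        refine ⟨fun hb => ?_, fun hb => ?_⟩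
        · have := (hh b hb.1).def hε
          obtain ⟨δ, hδ, hball⟩ := Metric.eventually_nhds_iff.1 this
          obtain ⟨n, hn⟩ := exists_nat_one_div_lt hδ
          refine mem_iUnion.2 ⟨n, hb, fun y hy => ?_⟩
          have := hball (y := y) (by rw [dist_eq_norm]; exact hy.trans hn)
          simpa using this
        · obtain ⟨n, hn⟩ := mem_iUnion.1 hb
          exact hn.1
      rw [hun, hmono.measure_iUnion]
      refine iSup_le fun n => ?_
      exact volume_image_le_of_norm_sub_le hs hpq (fun b hb => hb.1.2)
        Metric.isOpen_ball.measurableSet hε.le (by positivity) (fun b hb => hb.2)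
    have hlim : Filter.Tendsto (fun ε : ℝ => ENNReal.ofReal ε ^ q * volume V) (𝓝[>] 0) (𝓝 0) := by
      have h1 : Filter.Tendsto (fun ε : ℝ => ENNReal.ofReal ε ^ q) (𝓝 0) (𝓝 0) := by
        have : Continuous fun ε : ℝ => ENNReal.ofReal ε ^ q :=
          (ENNReal.continuous_pow q).comp ENNReal.continuous_ofReal
        simpa [show q ≠ 0 by omega] using this.tendsto 0
      have h2 := ENNReal.Tendsto.mul_const (b := volume V) h1
        (Or.inr Metric.isBounded_ball.measure_lt_top.ne)
      rw [zero_mul] at h2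
      exact h2.mono_left nhdsWithin_le_nhds
    exact le_antisymm (ge_of_tendsto hlim (eventually_mem_nhdsWithin.mono fun ε hε => hle ε hε))
      zero_le
  have hun : h '' B = ⋃ R : ℕ, h '' (B ∩ Metric.ball 0 R) := by
    rw [← image_iUnion, ← inter_iUnion, Metric.iUnion_ball_nat, inter_univ]
  rw [hun, measure_iUnion_null_iff]
  exact hbdd

end ImageNull

/-! ### Sard's theorem. -/

section Sard

/-- If `R` is a right inverse of `L`, then `M ∘ R` is invertible for `M` near `L`, because the units
are open. -/
theorem isOpen_setOf_surjective {E F : Type*} [NormedAddCommGroup E] [NormedSpace ℝ E]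
    [NormedAddCommGroup F] [NormedSpace ℝ F] [FiniteDimensional ℝ F] :
    IsOpen {L : E →L[ℝ] F | Function.Surjective L} := by
  rw [isOpen_iff_mem_nhds]
  intro L hL
  obtain ⟨R, hR⟩ := L.toLinearMap.exists_rightInverse_of_surjective (LinearMap.range_eq_top.2 hL)
  have : CompleteSpace F := FiniteDimensional.complete ℝ F
  set R' : F →L[ℝ] E := LinearMap.toContinuousLinearMap R with hR'
  have hcont : Continuous fun M : E →L[ℝ] F => M.comp R' := by fun_prop
  have hunit : IsUnit (L.comp R') := by
    have : L.comp R' = 1 := by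
      ext x
      exact congrArg (fun T : F →ₗ[ℝ] F => T x) hR
    rw [this]
    exact isUnit_one
  filter_upwards [hcont.continuousAt.preimage_mem_nhds (Units.isOpen.mem_nhds hunit)] with M hM
  have hM' : IsUnit (M.comp R') := hM
  obtain ⟨u, hu⟩ := hM'
  intro y
  refine ⟨R' ((↑u⁻¹ : F →L[ℝ] F) y), ?_⟩
  have h1 : (u : F →L[ℝ] F) ((↑u⁻¹ : F →L[ℝ] F) y) = y :=
    congrArg (fun T : F →L[ℝ] F => T y) u.mul_inv
  rw [hu] at h1
  exact h1

/-- The image of the set of zeros of the derivative. -/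
theorem volume_image_fderiv_eq_zero {E : Type} [NormedAddCommGroup E] [NormedSpace ℝ E]
    [FiniteDimensional ℝ E] {q s : ℕ} (hs : 1 ≤ s) (hq : 1 ≤ q)
    (hE : Module.finrank ℝ E ≤ s * q) {f : E → Fin q → ℝ} {A : Set E}
    (hf : ∀ a ∈ A, ContDiffAt ℝ s f a) (hA : ∀ a ∈ A, fderiv ℝ f a = 0) :
    volume (f '' A) = 0 := by
  obtain ⟨s, rfl⟩ := Nat.exists_eq_add_of_le' hs
  obtain ⟨C, hC, hAC, hT⟩ := isMorseCovered_self s _ E A rfl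
  refine measure_mono_null (t := ⋃ T ∈ C, f '' T) ?_ ((measure_biUnion_null_iff hC).2 ?_)
  · rw [← image_iUnion₂, ← sUnion_eq_biUnion]
    exact image_mono hAC
  intro T hTC
  obtain ⟨p, ψ, B, hp, hS, hB⟩ := hT T hTC
  refine measure_mono_null (image_mono hS) ?_
  rw [← image_comp]
  refine volume_image_eq_zero_of_isLittleO hs hq (hp.trans hE) fun b hb => ?_
  obtain ⟨h1, h2, h3⟩ := hB b hb
  exact isLittleO_comp_sub_of_fderiv (f := f) h2
    ((hf _ h1).of_le (by exact_mod_cast Nat.le_add_left 1 s))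
    (h3 _ (fderiv ℝ f) (fun a ha => (hf a ha).fderiv_right (by push_cast; rfl)) hA)

/-- A linear map `X × Y → ℝ × G` that preserves the first coordinate is surjective if its
restriction to the second factors is. -/
theorem surjective_of_fst_of_inr {Y G : Type*} [AddCommGroup Y] [Module ℝ Y]
    [AddCommGroup G] [Module ℝ G] {T : (ℝ × Y) →ₗ[ℝ] ℝ × G} (h1 : ∀ z, (T z).1 = z.1)
    (h2 : Function.Surjective fun y => (T ((0 : ℝ), y)).2) : Function.Surjective T := by
  rintro ⟨a, z⟩
  obtain ⟨y, hy⟩ := h2 (z - (T (a, 0)).2)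
  refine ⟨(a, y), Prod.ext (h1 _) ?_⟩
  have : ((a, y) : ℝ × Y) = (a, 0) + ((0 : ℝ), y) := by simp
  rw [this, map_add, Prod.snd_add]
  change _ + (T ((0 : ℝ), y)).2 = z
  rw [show (T ((0 : ℝ), y)).2 = _ from hy]
  abel

/-- **Sard's theorem** with sharp differentiability. -/
theorem volume_image_not_surjective_fderiv (q : ℕ) : ∀ (E : Type) [NormedAddCommGroup E]
    [NormedSpace ℝ E] [FiniteDimensional ℝ E] (s : ℕ) (U : Set E) (f : E → Fin q → ℝ),
    1 ≤ s → Module.finrank ℝ E < s + q → IsOpen U → ContDiffOn ℝ s f U →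
      volume (f '' {x | x ∈ U ∧ ¬ Function.Surjective (fderiv ℝ f x)}) = 0 := by
  induction q with
  | zero =>
    intro E _ _ _ s U f hs hE hU hf
    have : {x | x ∈ U ∧ ¬ Function.Surjective (fderiv ℝ f x)} = ∅ := by
      ext x
      simp only [mem_ofPred_eq, mem_empty_iff_false, iff_false, not_and, not_not]
      intro _ y
      exact ⟨0, Subsingleton.elim _ _⟩
    simp [this]
  | succ q ih =>
  intro E _ _ _ s U f hs hE hU hf
  have hs0 : (s : WithTop ℕ∞) ≠ 0 := by exact_mod_cast (by omega : s ≠ 0)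
  have hfa : ∀ x ∈ U, ContDiffAt ℝ s f x := fun x hx => hf.contDiffAt (hU.mem_nhds hx)
  set C : Set E := {x | x ∈ U ∧ ¬ Function.Surjective (fderiv ℝ f x)} with hC
  have hzero : volume (f '' (C ∩ {x | fderiv ℝ f x = 0})) = 0 := by
    refine volume_image_fderiv_eq_zero hs (Nat.le_add_left 1 q) ?_ (fun a ha => hfa a ha.1.1)
      fun a ha => ha.2
    -- The dimension is at most s + q, and s + q ≤ s(q + 1) because s ≥ 1.
    nlinarith
  have hloc : ∀ x ∈ C ∩ {x | fderiv ℝ f x ≠ 0}, ∃ O ∈ 𝓝 x, volume (f '' (C ∩ O)) = 0 := by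
    rintro x ⟨⟨hxU, -⟩, hx0⟩
    obtain ⟨j, hj⟩ : ∃ j, fderiv ℝ (fun y => f y j) x ≠ 0 := by
      by_contra! hcon
      refine hx0 ?_
      rw [fderiv_pi fun j => ?_]
      · ext v j
        simp [hcon j]
      · exact ((contDiffAt_pi.1 (hfa x hxU)) j).differentiableAt hs0
    obtain ⟨H, Ψ, hdim, hxs, hsU, hfst, hsymm⟩ :=
      exists_straightening hs ((contDiffAt_pi.1 (hfa x hxU)) j) hj (hU.mem_nhds hxU)
    have : ProperSpace E := FiniteDimensional.proper_real E
    obtain ⟨ρ, hρ, hK⟩ := Metric.nhds_basis_closedBall.mem_iff.1 (Ψ.open_source.mem_nhds hxs)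
    set K := Metric.closedBall x ρ with hKdef
    refine ⟨K, Metric.closedBall_mem_nhds x hρ, ?_⟩
    have hKU : K ⊆ U := hK.trans hsU
    -- Compactness makes the image of the critical set measurable, as Fubini requires.
    have hcompact : IsCompact (C ∩ K) := by
      have h1 : ContinuousOn (fderiv ℝ f) K :=
        (hf.continuousOn_fderiv_of_isOpen hU (by exact_mod_cast hs)).mono hKU
      have h2 : C ∩ K = K ∩ fderiv ℝ f ⁻¹' {L | ¬ Function.Surjective L} := by
        ext y
        exact ⟨fun hy => ⟨hy.2, hy.1.2⟩, fun hy => ⟨⟨hKU hy.1, hy.2⟩, hy.1⟩⟩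
      rw [h2]
      exact (isCompact_closedBall x ρ).of_isClosed_subset
        (h1.preimage_isClosed_of_isClosed Metric.isClosed_closedBall
          isOpen_setOf_surjective.isClosed_compl) inter_subset_left
    have hfc : ContinuousOn f (C ∩ K) := hf.continuousOn.mono (inter_subset_right.trans hKU)
    have hmeas : MeasurableSet (f '' (C ∩ K)) := (hcompact.image_of_continuousOn hfc).measurableSet
    set e := MeasurableEquiv.piFinSuccAbove (fun _ : Fin (q + 1) => ℝ) j with he
    have hpres := volume_preserving_piFinSuccAbove (fun _ : Fin (q + 1) => ℝ) j
    have h3 : volume (f '' (C ∩ K)) = volume (e.symm ⁻¹' (f '' (C ∩ K))) :=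
      (hpres.symm.measure_preimage hmeas.nullMeasurableSet).symm
    rw [h3, Measure.volume_eq_prod, Measure.measure_prod_null (e.symm.measurable hmeas)]
    -- Every slice is null. In the chart the derivative of `f` is block triangular with `fderiv ℝ g`
    -- as a diagonal block, so critical points of `f` on the level set of `f j` at `u` are critical
    -- points of `g`; source and target of `g` have one dimension less.
    refine Filter.Eventually.of_forall fun u => ?_
    set V : Set H := {y | (u, y) ∈ Ψ.target} with hV
    set g : H → Fin q → ℝ := fun y i => f (Ψ.symm (u, y)) (j.succAbove i) with hg
    have hVo : IsOpen V := Ψ.open_target.preimage (by fun_prop)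
    have hθ : ∀ y ∈ V, ContDiffAt ℝ s (fun y : H => Ψ.symm (u, y)) y := fun y hy =>
      (hsymm _ hy).comp y (contDiffAt_const.prodMk contDiffAt_id)
    have hgV : ContDiffOn ℝ s g V := fun y hy => by
      refine ContDiffAt.contDiffWithinAt (contDiffAt_pi.2 fun i => ?_)
      exact (contDiffAt_pi.1 ((hfa _ (hsU (Ψ.map_target hy))).comp y (hθ y hy))) _
    refine measure_mono_null ?_ (ih H s V g hs (by omega) hVo hgV)
    rintro z ⟨y, ⟨hyC, hyK⟩, hyz⟩
    have hyu : f y j = u := by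
      rw [hyz]
      exact Fin.insertNth_apply_same (α := fun _ => ℝ) j u z
    have hyz' : ∀ i, f y (j.succAbove i) = z i := by
      intro i
      rw [hyz]
      exact Fin.insertNth_apply_succAbove (α := fun _ => ℝ) j u z i
    have hys := hK hyK
    have hΨy : Ψ y = (u, (Ψ y).2) := Prod.ext ((hfst y hys).trans hyu) rfl
    have hyV : (u, (Ψ y).2) ∈ Ψ.target := hΨy ▸ Ψ.map_source hys
    have hsy : Ψ.symm (u, (Ψ y).2) = y := by rw [← hΨy, Ψ.left_inv hys]
    refine ⟨(Ψ y).2, ⟨hyV, fun hsurj => hyC.2 ?_⟩, ?_⟩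
    swap
    · ext i
      simp only [hg, hsy, hyz']
    have hd1 : HasFDerivAt Ψ.symm (fderiv ℝ Ψ.symm (u, (Ψ y).2)) (u, (Ψ y).2) :=
      ((hsymm _ hyV).differentiableAt hs0).hasFDerivAt
    have hd2 : HasFDerivAt f (fderiv ℝ f y) (Ψ.symm (u, (Ψ y).2)) := by
      rw [hsy]
      exact ((hfa y hyC.1).differentiableAt hs0).hasFDerivAt
    have hd3 := hd2.comp _ hd1
    set T := (fderiv ℝ f y).comp (fderiv ℝ Ψ.symm (u, (Ψ y).2)) with hTdef
    have hTj : ∀ z, T z j = z.1 := by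
      have h4 : HasFDerivAt (fun z => f (Ψ.symm z) j)
          ((ContinuousLinearMap.proj j).comp T) (u, (Ψ y).2) :=
        (hasFDerivAt_pi'.1 hd3) j
      have h5 : HasFDerivAt (fun z : ℝ × H => f (Ψ.symm z) j)
          (ContinuousLinearMap.fst ℝ ℝ H) (u, (Ψ y).2) := by
        refine hasFDerivAt_fst.congr_of_eventuallyEq ?_
        filter_upwards [Ψ.open_target.mem_nhds hyV] with z hz
        rw [← hfst _ (Ψ.map_target hz), Ψ.right_inv hz]
      intro z
      exact congrArg (fun L : ℝ × H →L[ℝ] ℝ => L z) (h4.unique h5)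
    have hTg : ∀ v i, fderiv ℝ g (Ψ y).2 v i = T ((0 : ℝ), v) (j.succAbove i) := by
      intro v i
      have h6 : HasFDerivAt g (ContinuousLinearMap.pi fun i =>
          ((ContinuousLinearMap.proj (j.succAbove i)).comp T).comp
            (ContinuousLinearMap.inr ℝ ℝ H)) (Ψ y).2 := by
        rw [hasFDerivAt_pi]
        intro i
        exact ((hasFDerivAt_pi'.1 hd3) (j.succAbove i)).comp (Ψ y).2
          (hasFDerivAt_prodMk_right u (Ψ y).2)
      rw [h6.fderiv]
      rfl
    have hTs : Function.Surjective T := by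
      intro w
      let T' : (ℝ × H) →ₗ[ℝ] ℝ × (Fin q → ℝ) :=
        ((LinearMap.proj j).prod (LinearMap.pi fun i => LinearMap.proj (j.succAbove i))).comp
          T.toLinearMap
      have hT's : Function.Surjective T' := by
        refine surjective_of_fst_of_inr hTj ?_
        intro z
        obtain ⟨v, hv⟩ := hsurj z
        refine ⟨v, ?_⟩
        ext i
        rw [← hv, hTg]
        rfl
      obtain ⟨a, ha⟩ := hT's (w j, fun i => w (j.succAbove i))
      refine ⟨a, ?_⟩
      ext i
      induction i using Fin.succAboveCases j with
      | x => exact congrArg Prod.fst ha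
      | p i => exact congrFun (congrArg Prod.snd ha) i
    intro w
    obtain ⟨a, ha⟩ := hTs w
    exact ⟨_, ha⟩
  have hone : volume (f '' (C ∩ {x | fderiv ℝ f x ≠ 0})) = 0 := by
    choose! O hO hOnull using hloc
    have : ProperSpace E := FiniteDimensional.proper_real E
    obtain ⟨t, htS, htc, ht⟩ := countable_cover_nhdsWithin (s := C ∩ {x | fderiv ℝ f x ≠ 0})
      (f := O) fun x hx => mem_nhdsWithin_of_mem_nhds (hO x hx)
    refine measure_mono_null (t := ⋃ i ∈ t, f '' (C ∩ O i)) ?_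
      ((measure_biUnion_null_iff htc).2 fun i hi => hOnull i (htS hi))
    rintro _ ⟨y, hy, rfl⟩
    obtain ⟨i, hi, hyi⟩ := mem_iUnion₂.1 (ht hy)
    exact mem_iUnion₂.2 ⟨i, hi, mem_image_of_mem f ⟨hy.1, hyi⟩⟩
  refine measure_mono_null ?_ (measure_union_null hzero hone)
  rw [← image_union, ← inter_union_distrib_left]
  refine image_mono fun x hx => ⟨hx, ?_⟩
  exact em (fderiv ℝ f x = 0)

end Sard

/-! ### Jets as linear images of the derivatives. -/

section Jets

variable {E : Type*} [NormedAddCommGroup E] [NormedSpace ℝ E]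
variable {F : Type*} [NormedAddCommGroup F] [NormedSpace ℝ F]

/-- The inclusion of the symmetric maps in the multilinear maps, in all degrees up to `k`. -/
def jetInclusion (k : ℕ) : JetFiber E F k →ₗ[ℝ] (i : Fin (k + 1)) → E [×i]→L[ℝ] F where
  toFun w i := w i
  map_add' _ _ := rfl
  map_smul' _ _ := rfl

theorem jetInclusion_injective (k : ℕ) :
    Function.Injective (jetInclusion (E := E) (F := F) k) := fun _ _ h =>
  funext fun i => Subtype.ext (congrFun h i)

/-- The derivatives of `f` up to order `k`. -/
noncomputable def derivs (k : ℕ) (f : E → F) (x : E) : (i : Fin (k + 1)) → E [×i]→L[ℝ] F :=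
  fun i => iteratedFDeriv ℝ i f x

theorem jetInclusion_jet {k : ℕ} {f : E → F} {x : E} (hf : ContDiffAt ℝ k f x) :
    jetInclusion k (jet k f x).2 = derivs k f x :=
  funext fun i => coe_jet_snd hf i

theorem derivs_add {k : ℕ} {f g : E → F} {x : E} (hf : ContDiffAt ℝ k f x)
    (hg : ContDiffAt ℝ k g x) : derivs k (f + g) x = derivs k f x + derivs k g x := by
  funext i
  have hi : ((i : ℕ) : WithTop ℕ∞) ≤ k := by exact_mod_cast Nat.lt_succ_iff.1 i.2
  exact iteratedFDeriv_add_apply (hf.of_le hi) (hg.of_le hi)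

theorem derivs_const_smul {k : ℕ} {f : E → F} {x : E} (a : ℝ) (hf : ContDiffAt ℝ k f x) :
    derivs k (a • f) x = a • derivs k f x := by
  funext i
  have hi : ((i : ℕ) : WithTop ℕ∞) ≤ k := by exact_mod_cast Nat.lt_succ_iff.1 i.2
  exact iteratedFDeriv_const_smul_apply (hf.of_le hi)

theorem contDiffAt_derivs {k s : ℕ} {f : E → F} {x : E}
    (hf : ContDiffAt ℝ (k + s : ℕ) f x) : ContDiffAt ℝ s (derivs k f) x := by
  refine contDiffAt_pi.2 fun i => hf.iteratedFDeriv_right ?_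
  have := Nat.lt_succ_iff.1 i.2
  exact_mod_cast (by omega : s + i ≤ k + s)

theorem derivs_congr {k : ℕ} {f g : E → F} {x : E} (h : f =ᶠ[𝓝 x] g) :
    derivs k f x = derivs k g x :=
  funext fun i => (Filter.EventuallyEq.iteratedFDeriv ℝ h i).eq_of_nhds

theorem jet_congr {k : ℕ} {f g : E → F} {x : E} (h : f =ᶠ[𝓝 x] g) : jet k f x = jet k g x := by
  refine Prod.ext rfl (funext fun i => ?_)
  simp only [jet]
  rw [(Filter.EventuallyEq.iteratedFDeriv ℝ h i).eq_of_nhds]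

variable [FiniteDimensional ℝ E] [FiniteDimensional ℝ F]

instance finiteDimensional_continuousMultilinearMap (i : ℕ) :
    FiniteDimensional ℝ (E [×i]→L[ℝ] F) :=
  FiniteDimensional.of_injective
    (⟨⟨ContinuousMultilinearMap.toMultilinearMap, fun _ _ => rfl⟩, fun _ _ => rfl⟩ :
      (E [×i]→L[ℝ] F) →ₗ[ℝ] MultilinearMap ℝ (fun _ : Fin i => E) F)
    ContinuousMultilinearMap.toMultilinearMap_injective

instance finiteDimensional_jetFiber (k : ℕ) : FiniteDimensional ℝ (JetFiber E F k) :=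
  inferInstanceAs (FiniteDimensional ℝ ((i : Fin (k + 1)) → symMultilinear E F i))

/-- A linear left inverse turns the jet, defined by a case distinction on symmetry, into a fixed
linear map of the derivatives, through which smoothness and continuity pass. -/
theorem exists_jetProjection (k : ℕ) :
    ∃ π : ((i : Fin (k + 1)) → E [×i]→L[ℝ] F) →L[ℝ] JetFiber E F k,
      ∀ w, π (jetInclusion k w) = w := by
  obtain ⟨π, hπ⟩ := (jetInclusion (E := E) (F := F) k).exists_leftInverse_of_injective
    (LinearMap.ker_eq_bot.2 (jetInclusion_injective k))
  exact ⟨LinearMap.toContinuousLinearMap π, fun w => LinearMap.congr_fun hπ w⟩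

variable (E F) in
/-- A projection of the multilinear maps onto the symmetric maps, in all degrees up to `k`. -/
noncomputable def jetProjection (k : ℕ) :
    ((i : Fin (k + 1)) → E [×i]→L[ℝ] F) →L[ℝ] JetFiber E F k :=
  (exists_jetProjection k).choose

theorem jetProjection_jetInclusion {k : ℕ} (w : JetFiber E F k) :
    jetProjection E F k (jetInclusion k w) = w :=
  (exists_jetProjection k).choose_spec w

theorem jet_eq {k : ℕ} {f : E → F} {x : E} (hf : ContDiffAt ℝ k f x) :
    jet k f x = (x, jetProjection E F k (derivs k f x)) := by
  rw [← jetInclusion_jet hf, jetProjection_jetInclusion]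
  rfl

end Jets

/-! ### Polynomials with prescribed jets. -/

section PolynomialMaps

variable {E F : Type} [NormedAddCommGroup E] [NormedSpace ℝ E]
variable [NormedAddCommGroup F] [NormedSpace ℝ F]

/-- The polynomial function with given homogeneous components. -/
def polyFun {k : ℕ} (q : (i : Fin (k + 1)) → E [×i]→L[ℝ] F) (y : E) : F :=
  ∑ i, q i fun _ => y

theorem contDiff_polyFun {k : ℕ} (q : (i : Fin (k + 1)) → E [×i]→L[ℝ] F) {s : WithTop ℕ∞} :
    ContDiff ℝ s (polyFun q) :=
  ContDiff.sum fun i _ => (q i).contDiff.comp (contDiff_pi.2 fun _ => contDiff_id)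

/-- The finite power series of `polyFun q`. -/
noncomputable def polySeries {k : ℕ} (q : (i : Fin (k + 1)) → E [×i]→L[ℝ] F) :
    FormalMultilinearSeries ℝ E F :=
  fun n => if h : n < k + 1 then q ⟨n, h⟩ else 0

theorem hasFiniteFPowerSeriesOnBall_polyFun {k : ℕ} (q : (i : Fin (k + 1)) → E [×i]→L[ℝ] F) :
    HasFiniteFPowerSeriesOnBall (polyFun q) (polySeries q) 0 (k + 1) ⊤ := by
  refine .mk' (fun m hm => ?_) (by simp) fun y _ => ?_
  · simp [polySeries, Nat.not_lt.2 hm]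
  · rw [zero_add, Finset.sum_range]
    refine Finset.sum_congr rfl fun i _ => ?_
    simp only [polySeries, i.2, dif_pos]

/-- Each differentiation lowers the bound on the power series by one, and a function with bound 0
vanishes. -/
theorem iteratedFDeriv_eq_zero_of_hasFinite (n : ℕ) : ∀ (F : Type) [NormedAddCommGroup F]
    [NormedSpace ℝ F] (f : E → F) (p : FormalMultilinearSeries ℝ E F),
      HasFiniteFPowerSeriesOnBall f p 0 n ⊤ → iteratedFDeriv ℝ n f = 0 := by
  induction n with
  | zero =>
    intro F _ _ f p h
    funext x
    ext v
    simpa using h.eq_zero_of_bound_zero x (by simp)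
  | succ n ih =>
    intro F _ _ f p h
    funext x
    rw [iteratedFDeriv_succ_eq_comp_right, ih _ _ _ h.fderiv]
    exact LinearIsometryEquiv.map_zero _

theorem iteratedFDeriv_polyFun_eq_zero {k : ℕ} (q : (i : Fin (k + 1)) → E [×i]→L[ℝ] F) :
    iteratedFDeriv ℝ (k + 1) (polyFun q) = 0 :=
  iteratedFDeriv_eq_zero_of_hasFinite _ _ _ _ (hasFiniteFPowerSeriesOnBall_polyFun q)

/-- A polynomial function of degree `≤ k` with vanishing derivatives up to order `k` at one point
has vanishing derivatives everywhere. -/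
theorem derivs_polyFun_eq_zero {k : ℕ} (q : (i : Fin (k + 1)) → E [×i]→L[ℝ] F) {x : E}
    (hx : derivs k (polyFun q) x = 0) (y : E) : derivs k (polyFun q) y = 0 := by
  -- Descending induction on the order k + 1 - j: a derivative whose own derivative is zero is
  -- constant, and it vanishes at `x`.
  have key : ∀ j, j ≤ k + 1 → iteratedFDeriv ℝ (k + 1 - j) (polyFun q) = 0 := by
    intro j
    induction j with
    | zero => exact fun _ => iteratedFDeriv_polyFun_eq_zero q
    | succ j ih =>
      intro hj
      have h1 := ih (by omega)
      obtain ⟨i, hi⟩ : ∃ i, k + 1 - j = i + 1 := ⟨k - j, by omega⟩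
      rw [hi] at h1
      have hi' : k + 1 - (j + 1) = i := by omega
      rw [hi']
      have hd : Differentiable ℝ (iteratedFDeriv ℝ i (polyFun q)) :=
        (contDiff_polyFun q (s := (i + 1 : ℕ))).differentiable_iteratedFDeriv
          (by exact_mod_cast Nat.lt_succ_self i)
      have hz : ∀ z, fderiv ℝ (iteratedFDeriv ℝ i (polyFun q)) z = 0 := by
        intro z
        rw [fderiv_iteratedFDeriv, h1]
        exact LinearIsometryEquiv.map_zero _
      funext z
      rw [is_const_of_fderiv_eq_zero hd hz z x]
      exact congrFun hx ⟨i, by omega⟩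
  funext i
  have h := key (k + 1 - i) (by omega)
  rw [show k + 1 - (k + 1 - (i : ℕ)) = i by omega] at h
  exact congrFun h y

/-- The scaled components of a jet, the coefficients of its polynomial. -/
noncomputable def jetCoeff {k : ℕ} (w : JetFiber E F k) : (i : Fin (k + 1)) → E [×i]→L[ℝ] F :=
  fun i => ((i : ℕ).factorial : ℝ)⁻¹ • jetInclusion k w i

/-- The polynomial function with the given jet at the origin. -/
noncomputable def jetPoly {k : ℕ} (w : JetFiber E F k) : E → F := polyFun (jetCoeff w)

theorem contDiff_jetPoly {k : ℕ} (w : JetFiber E F k) {s : WithTop ℕ∞} :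
    ContDiff ℝ s (jetPoly w) := contDiff_polyFun _

theorem jetPoly_add {k : ℕ} (w w' : JetFiber E F k) :
    jetPoly (w + w') = jetPoly w + jetPoly w' := by
  funext y
  simp [jetPoly, polyFun, jetCoeff, Finset.sum_add_distrib]

theorem jetPoly_smul {k : ℕ} (a : ℝ) (w : JetFiber E F k) :
    jetPoly (a • w) = a • jetPoly w := by
  funext y
  simp only [jetPoly, polyFun, jetCoeff, map_smul, Pi.smul_apply, Finset.smul_sum,
    smul_apply]
  exact Finset.sum_congr rfl fun i _ => smul_comm _ _ _

/-- The i-th derivative at the centre of a power series sums the i-th coefficient over all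
permutations of the arguments; by symmetry this gives i! equal terms, which cancel the factor in
`jetCoeff`. -/
theorem derivs_jetPoly_zero [CompleteSpace F] {k : ℕ} (w : JetFiber E F k) :
    derivs k (jetPoly w) 0 = jetInclusion k w := by
  funext i
  ext v
  have h := (hasFiniteFPowerSeriesOnBall_polyFun
    (jetCoeff w)).toHasFPowerSeriesOnBall.iteratedFDeriv_eq_sum_of_completeSpace (n := i) v
  refine h.trans ?_
  have hsym : ∀ σ : Equiv.Perm (Fin i), (polySeries (jetCoeff w) i fun a => v (σ a)) =
      ((i : ℕ).factorial : ℝ)⁻¹ • jetInclusion k w i v := by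
    intro σ
    have h1 : (jetInclusion k w i) (v ∘ σ) = jetInclusion k w i v := (w i).2 σ v
    simp only [polySeries, i.2, dif_pos, jetCoeff, smul_apply]
    exact congrArg _ h1
  rw [Finset.sum_congr rfl fun σ _ => hsym σ, Finset.sum_const, Finset.card_univ,
    Fintype.card_perm, Fintype.card_fin, ← Nat.cast_smul_eq_nsmul ℝ, smul_smul,
    mul_inv_cancel₀ (by exact_mod_cast (Nat.factorial_ne_zero _)), one_smul]

/-- Every polynomial function of degree at most `k` is that of a jet. -/
theorem exists_jetPoly_eq {k : ℕ} (q : (i : Fin (k + 1)) → E [×i]→L[ℝ] F) :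
    ∃ w : JetFiber E F k, jetPoly w = polyFun q := by
  -- Symmetrization leaves the values on the diagonal unchanged; its factor 1/i! is already in
  -- `jetCoeff`.
  have hmem : ∀ i : Fin (k + 1), (∑ σ : Equiv.Perm (Fin i), (q i).domDomCongr σ) ∈
      symMultilinear E F i := by
    intro i τ v
    simp only [sum_apply, ContinuousMultilinearMap.domDomCongr_apply]
    exact Fintype.sum_equiv (Equiv.mulLeft τ) _
      (fun σ : Equiv.Perm (Fin i) => q i fun a => v (σ a)) fun σ => rfl
  let w : JetFiber E F k := fun i => ⟨_, hmem i⟩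
  refine ⟨w, ?_⟩
  funext y
  change ∑ i, jetCoeff w i (fun _ => y) = ∑ i, q i fun _ => y
  refine Finset.sum_congr rfl fun i _ => ?_
  have h : jetInclusion k w i (fun _ => y) = ((i : ℕ).factorial : ℝ) • q i fun _ => y := by
    change (∑ σ : Equiv.Perm (Fin i), (q i).domDomCongr σ) _ = _
    rw [sum_apply]
    simp only [ContinuousMultilinearMap.domDomCongr_apply]
    rw [Finset.sum_const, Finset.card_univ, Fintype.card_perm, Fintype.card_fin,
      ← Nat.cast_smul_eq_nsmul ℝ]
  simp only [jetCoeff, smul_apply]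
  rw [h, smul_smul, inv_mul_cancel₀ (by exact_mod_cast (Nat.factorial_ne_zero _)), one_smul]

variable [FiniteDimensional ℝ E] [FiniteDimensional ℝ F]

/-- The jet at `x` of the polynomial with a given jet at the origin. -/
noncomputable def jetShift (k : ℕ) (x : E) : JetFiber E F k →L[ℝ] JetFiber E F k :=
  LinearMap.toContinuousLinearMap
    { toFun := fun w => jetProjection E F k (derivs k (jetPoly w) x)
      map_add' := fun w w' => by
        rw [jetPoly_add, derivs_add (contDiff_jetPoly w).contDiffAt
          (contDiff_jetPoly w').contDiffAt, map_add]
      map_smul' := fun a w => by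
        rw [jetPoly_smul, derivs_const_smul a (contDiff_jetPoly w).contDiffAt, map_smul]
        rfl }

theorem jetShift_apply {k : ℕ} (x : E) (w : JetFiber E F k) :
    jetShift k x w = jetProjection E F k (derivs k (jetPoly w) x) := rfl

theorem jetInclusion_jetShift {k : ℕ} (x : E) (w : JetFiber E F k) :
    jetInclusion k (jetShift k x w) = derivs k (jetPoly w) x := by
  rw [jetShift_apply, ← jetInclusion_jet (contDiff_jetPoly w).contDiffAt,
    jetProjection_jetInclusion]

theorem jetShift_injective {k : ℕ} (x : E) :
    Function.Injective (jetShift (E := E) (F := F) k x) := by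
  rw [injective_iff_map_eq_zero]
  intro w hw
  have h1 := jetInclusion_jetShift x w
  rw [hw, map_zero] at h1
  have h2 := derivs_polyFun_eq_zero _ h1.symm 0
  have : CompleteSpace F := FiniteDimensional.complete ℝ F
  apply jetInclusion_injective k
  rw [← derivs_jetPoly_zero, map_zero]
  exact h2

theorem jetShift_isInvertible {k : ℕ} (x : E) :
    (jetShift (E := E) (F := F) k x).IsInvertible :=
  ⟨(LinearEquiv.ofInjectiveEndo (jetShift (E := E) (F := F) k x).toLinearMap
    (jetShift_injective x)).toContinuousLinearEquiv, by ext; rfl⟩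

theorem contDiff_jetShift {k : ℕ} {s : ℕ} :
    ContDiff ℝ s (jetShift (E := E) (F := F) k) := by
  rw [contDiff_clm_apply_iff]
  intro w
  refine contDiff_iff_contDiffAt.2 fun x => ?_
  exact (jetProjection E F k).contDiff.contDiffAt.comp x
    (contDiffAt_derivs (contDiff_jetPoly w).contDiffAt)

/-- The polynomial to be added to `f` in order to obtain a given jet. -/
noncomputable def jetDiff (k : ℕ) (f : E → F) (z : Jet E F k) : JetFiber E F k :=
  (jetShift k z.1).inverse (z.2 - jetProjection E F k (derivs k f z.1))

/-- Thus `jetDiff k f` is constant along the jet of `f + jetPoly w`. -/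
theorem jetDiff_jet_add {k : ℕ} {f : E → F} {x : E} (hf : ContDiffAt ℝ k f x)
    (w : JetFiber E F k) : jetDiff k f (jet k (f + jetPoly w) x) = w := by
  have hw : ContDiffAt ℝ k (jetPoly w) x := (contDiff_jetPoly w).contDiffAt
  rw [jetDiff, jet_eq (f := f + jetPoly w) (hf.add hw), derivs_add hf hw, map_add,
    add_sub_cancel_left, ← jetShift_apply]
  obtain ⟨e, he⟩ := jetShift_isInvertible (F := F) (k := k) x
  rw [← he, ContinuousLinearMap.inverse_equiv]
  exact e.symm_apply_apply w

/-- Only the derivatives of `f` up to order `k` enter, and inversion is smooth at invertible maps.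
-/
theorem contDiffAt_jetDiff {k s : ℕ} {f : E → F} {z : Jet E F k}
    (hf : ContDiffAt ℝ (k + s : ℕ) f z.1) : ContDiffAt ℝ s (jetDiff k f) z := by
  have h1 : ContDiffAt ℝ s (fun z : Jet E F k => (jetShift (F := F) k z.1).inverse) z := by
    have h := (jetShift_isInvertible (F := F) (k := k) z.1).contDiffAt_map_inverse
      (n := (s : WithTop ℕ∞))
    exact h.comp z (contDiff_jetShift.contDiffAt.comp z contDiffAt_fst)
  have h2 : ContDiffAt ℝ s
      (fun z : Jet E F k => z.2 - jetProjection E F k (derivs k f z.1)) z :=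
    contDiffAt_snd.sub ((jetProjection E F k).contDiff.contDiffAt.comp z
      ((contDiffAt_derivs hf).comp z contDiffAt_fst))
  exact h1.clm_apply h2

end PolynomialMaps

/-! ### The topology of the space of C^l functions. -/

namespace CFun

variable {E : Type*} [NormedAddCommGroup E] [NormedSpace ℝ E]
variable {F : Type*} [NormedAddCommGroup F] [NormedSpace ℝ F]
variable {l : ℕ∞} {A : Opens E}

theorem contDiffAt (f : CFun F l A) {i : ℕ} (hi : (i : ℕ∞) ≤ l) {x : E} (hx : x ∈ A) :
    ContDiffAt ℝ i (f : E → F) x :=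
  (f.2.1.contDiffAt (A.isOpen.mem_nhds hx)).of_le (by exact_mod_cast hi)

theorem coe_add (f g : CFun F l A) : ((f + g : CFun F l A) : E → F) = (f : E → F) + g := rfl

theorem tendsto_iff {ι : Type*} {u : Filter ι} {g : ι → CFun F l A} {f : CFun F l A} :
    Filter.Tendsto g u (𝓝 f) ↔ ∀ i : ℕ, (i : ℕ∞) ≤ l → ∀ K : Set E, IsCompact K → K ⊆ A →
      TendstoUniformlyOn (fun j => iteratedFDeriv ℝ i (g j : E → F))
        (iteratedFDeriv ℝ i (f : E → F)) u K := by
  rw [nhds_iInf, Filter.tendsto_iInf]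
  refine forall_congr' fun i => ?_
  rw [nhds_iInf, Filter.tendsto_iInf]
  refine forall_congr' fun hi => ?_
  rw [nhds_induced, Filter.tendsto_comap_iff, UniformOnFun.tendsto_iff_tendstoUniformlyOn]
  exact ⟨fun h K h1 h2 => h K ⟨h1, h2⟩, fun h K hK => h K hK.1 hK.2⟩

theorem iteratedFDeriv_add (f g : CFun F l A) {i : ℕ} (hi : (i : ℕ∞) ≤ l) {x : E} (hx : x ∈ A) :
    iteratedFDeriv ℝ i ((f + g : CFun F l A) : E → F) x =
      iteratedFDeriv ℝ i (f : E → F) x + iteratedFDeriv ℝ i (g : E → F) x :=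
  iteratedFDeriv_add_apply (f.contDiffAt hi hx) (g.contDiffAt hi hx)

theorem iteratedFDeriv_smul (a : ℝ) (f : CFun F l A) {i : ℕ} (hi : (i : ℕ∞) ≤ l) {x : E}
    (hx : x ∈ A) : iteratedFDeriv ℝ i ((a • f : CFun F l A) : E → F) x =
      a • iteratedFDeriv ℝ i (f : E → F) x :=
  iteratedFDeriv_const_smul_apply (f.contDiffAt hi hx)

theorem continuousOn_iteratedFDeriv (f : CFun F l A) {i : ℕ} (hi : (i : ℕ∞) ≤ l) :
    ContinuousOn (iteratedFDeriv ℝ i (f : E → F)) A := fun x hx =>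
  ((f.contDiffAt hi hx).iteratedFDeriv_right (m := 0) (by simp)).continuousAt.continuousWithinAt

instance : ContinuousAdd (CFun F l A) := by
  refine ⟨continuous_iff_continuousAt.2 fun p => tendsto_iff.2 fun i hi K hK hKA => ?_⟩
  have h1 := tendsto_iff.1 (continuous_fst.tendsto p) i hi K hK hKA
  have h2 := tendsto_iff.1 (continuous_snd.tendsto p) i hi K hK hKA
  refine ((h1.add h2).congr (Filter.Eventually.of_forall fun q x hx => ?_)).congr_right
    fun x hx => ?_
  · exact (iteratedFDeriv_add _ _ hi (hKA hx)).symm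
  · exact (iteratedFDeriv_add _ _ hi (hKA hx)).symm

theorem continuous_smul_const (f : CFun F l A) : Continuous fun a : ℝ => a • f := by
  refine continuous_iff_continuousAt.2 fun a => tendsto_iff.2 fun i hi K hK hKA => ?_
  obtain ⟨C, hC⟩ := hK.exists_bound_of_continuousOn
    ((f.continuousOn_iteratedFDeriv hi).mono hKA)
  rw [Metric.tendstoUniformlyOn_iff]
  intro ε hε
  have hC0 : 0 < |C| + 1 := by positivity
  filter_upwards [Metric.ball_mem_nhds a (div_pos hε hC0)] with b hb x hx
  rw [iteratedFDeriv_smul _ _ hi (hKA hx), iteratedFDeriv_smul _ _ hi (hKA hx), dist_eq_norm,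
    ← sub_smul, norm_smul, Real.norm_eq_abs, abs_sub_comm]
  rw [Metric.mem_ball, Real.dist_eq, lt_div_iff₀ hC0] at hb
  refine lt_of_le_of_lt ?_ hb
  gcongr
  exact (hC x hx).trans ((le_abs_self C).trans (by linarith))

/-- The derivatives are jointly continuous in the function and the point. -/
theorem continuousAt_iteratedFDeriv [LocallyCompactSpace E] {i : ℕ} (hi : (i : ℕ∞) ≤ l)
    (f : CFun F l A) {x : E} (hx : x ∈ A) :
    ContinuousAt (fun p : CFun F l A × E => iteratedFDeriv ℝ i (p.1 : E → F) p.2) (f, x) := by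
  obtain ⟨K, hK, hKA, hKc⟩ := LocallyCompactSpace.local_compact_nhds x A (A.isOpen.mem_nhds hx)
  have h1 := tendsto_iff.1 (continuous_fst.tendsto (f, x)) i hi K hKc hKA
  have h2 : ContinuousAt (iteratedFDeriv ℝ i (f : E → F)) x :=
    (f.continuousOn_iteratedFDeriv hi).continuousAt (A.isOpen.mem_nhds hx)
  rw [Metric.continuousAt_iff']
  intro ε hε
  have h3 := Metric.tendstoUniformlyOn_iff.1 h1 (ε / 2) (half_pos hε)
  have h4 := (continuous_snd.tendsto (f, x)).eventually
    (Metric.continuousAt_iff'.1 h2 (ε / 2) (half_pos hε))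
  filter_upwards [h3, h4, (continuous_snd.tendsto (f, x)).eventually hK] with p h5 h6 h7
  refine (dist_triangle _ (iteratedFDeriv ℝ i (f : E → F) p.2) _).trans_lt ?_
  have := h5 p.2 h7
  rw [dist_comm] at this
  change _ < ε at *
  linarith

instance : T2Space (CFun F l A) := by
  have hinj : Function.Injective fun (f : CFun F l A) (x : A) => (f : E → F) x := by
    intro f g h
    refine Subtype.ext (funext fun x => ?_)
    by_cases hx : x ∈ A
    · exact congrFun h ⟨x, hx⟩
    · rw [f.2.2 x hx, g.2.2 x hx]
  refine T2Space.of_injective_continuous hinj (continuous_pi fun x => ?_)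
  refine continuous_iff_continuousAt.2 fun f => ?_
  have h := (tendsto_iff.1 (Filter.tendsto_id (x := 𝓝 f)) 0 (by simp) {x.1} isCompact_singleton
    (by simp)).tendsto_at (mem_singleton x.1)
  have h2 := ((ContinuousMultilinearMap.apply ℝ (fun _ : Fin 0 => E) F 0).continuous.tendsto
    _).comp h
  have h3 : Filter.Tendsto (fun g : CFun F l A => (g : E → F) x) (𝓝 f) (𝓝 ((f : E → F) x)) := by
    simpa [Function.comp_def] using h2
  exact h3

end CFun

theorem IsProbe.isPrevalent {V : Type*} [AddCommGroup V] [Module ℝ V] [TopologicalSpace V]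
    [MeasurableSpace V] {P : Submodule ℝ V} {T : Set V} (h : IsProbe P T) : IsPrevalent T := by
  obtain ⟨N, b, B, h1, h2, h3⟩ := h
  exact ⟨B, h1, h2, _, h3⟩

/-! ### Transversality of Lebesgue measure on a finite-dimensional subspace. -/

section LebesgueOnSpan

variable {V : Type*} [AddCommGroup V] [Module ℝ V] [TopologicalSpace V] [T2Space V]
  [ContinuousAdd V] [MeasurableSpace V] [BorelSpace V]

theorem isTransverse_lebesgueOnSpan {N : ℕ} {b : Fin N → V} (hb : LinearIndependent ℝ b)
    (hc : ∀ v : V, Continuous fun a : ℝ => a • v) {S : Set V} (hS : MeasurableSet S)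
    (hnull : ∀ v : V, volume {t : Fin N → ℝ | (∑ i, t i • b i) + v ∈ S} = 0) :
    IsTransverse (lebesgueOnSpan b) S := by
  have hcont : Continuous fun t : Fin N → ℝ => ∑ i, t i • b i :=
    continuous_finsetSum _ fun i _ => (hc (b i)).comp (continuous_apply i)
  have hinj : Function.Injective fun t : Fin N → ℝ => ∑ i, t i • b i :=
    hb.fintypeLinearCombination_injective
  constructor
  -- The image of the unit ball is the required compact set: it is Borel because the space is
  -- Hausdorff, and by injectivity its preimage is the ball itself.
  · have hK : IsCompact ((fun t : Fin N → ℝ => ∑ i, t i • b i) '' Metric.closedBall 0 1) :=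
      (isCompact_closedBall 0 1).image hcont
    refine ⟨_, hK, ?_⟩
    rw [lebesgueOnSpan, Measure.map_apply hcont.measurable hK.isClosed.measurableSet,
      hinj.preimage_image]
    exact ⟨Metric.measure_closedBall_pos _ _ one_pos,
      (isCompact_closedBall _ _).measure_lt_top⟩
  · intro v
    have himg : (fun s => s + v) '' S = (fun s => s + -v) ⁻¹' S :=
      congrFun (image_eq_preimage_of_inverse (fun s => add_neg_cancel_right s v)
        fun s => neg_add_cancel_right s v) S
    have hm : MeasurableSet ((fun s => s + -v) ⁻¹' S) :=
      (continuous_id.add continuous_const : Continuous fun s : V => s + -v).measurable hS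
    rw [himg, lebesgueOnSpan, Measure.map_apply hcont.measurable hm]
    exact hnull (-v)

end LebesgueOnSpan

/-! ### Derivatives of charts. -/

section Charts

variable {X Y : Type*} [NormedAddCommGroup X] [NormedSpace ℝ X]
variable [NormedAddCommGroup Y] [NormedSpace ℝ Y]

theorem fderiv_symm_fderiv_apply {φ : OpenPartialHomeomorph X Y} {x : X} (hx : x ∈ φ.source)
    (h1 : DifferentiableAt ℝ φ x) (h2 : DifferentiableAt ℝ φ.symm (φ x)) (v : X) :
    fderiv ℝ φ.symm (φ x) (fderiv ℝ φ x v) = v := by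
  have h := h2.hasFDerivAt.comp x h1.hasFDerivAt
  have hid : HasFDerivAt (φ.symm ∘ φ) (ContinuousLinearMap.id ℝ X) x :=
    (hasFDerivAt_id x).congr_of_eventuallyEq (by
      filter_upwards [φ.open_source.mem_nhds hx] with y hy using φ.left_inv hy)
  exact congrArg (fun L : X →L[ℝ] X => L v) (h.unique hid)

theorem fderiv_fderiv_symm_apply {φ : OpenPartialHomeomorph X Y} {x : X} (hx : x ∈ φ.source)
    (h1 : DifferentiableAt ℝ φ x) (h2 : DifferentiableAt ℝ φ.symm (φ x)) (v : Y) :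
    fderiv ℝ φ x (fderiv ℝ φ.symm (φ x) v) = v := by
  have h := fderiv_symm_fderiv_apply (φ := φ.symm) (φ.map_source hx) h2
    (by simpa [φ.left_inv hx] using h1) v
  simpa [φ.left_inv hx] using h

theorem finrank_eq_of_chart {φ : OpenPartialHomeomorph X Y} {x : X} (hx : x ∈ φ.source)
    (h1 : DifferentiableAt ℝ φ x) (h2 : DifferentiableAt ℝ φ.symm (φ x)) :
    Module.finrank ℝ X = Module.finrank ℝ Y :=
  LinearEquiv.finrank_eq (LinearEquiv.ofLinearMap (fderiv ℝ φ x).toLinearMap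
    (fderiv ℝ φ.symm (φ x)).toLinearMap
    (LinearMap.ext fun v => fderiv_fderiv_symm_apply hx h1 h2 v)
    (LinearMap.ext fun v => fderiv_symm_fderiv_apply hx h1 h2 v))

end Charts

/-! ### The polynomials as a subspace of the C^l functions. -/

section PolynomialSubspace

variable {E F : Type} [NormedAddCommGroup E] [NormedSpace ℝ E]
variable [NormedAddCommGroup F] [NormedSpace ℝ F]
variable {k : ℕ} {l : ℕ∞} {A : Opens E}

/-- The restriction to `A` of the polynomial with a given jet at the origin. -/
noncomputable def jetPolyOn (k : ℕ) (l : ℕ∞) (A : Opens E) : JetFiber E F k →ₗ[ℝ] CFun F l A where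
  toFun w := ⟨(A : Set E).indicator (jetPoly w),
    (contDiff_jetPoly w).contDiffOn.congr fun _ hx => indicator_of_mem hx _,
    fun _ hx => indicator_of_notMem hx _⟩
  map_add' w w' := Subtype.ext ((congrArg (A : Set E).indicator (jetPoly_add w w')).trans
    (indicator_add (A : Set E) (jetPoly w) (jetPoly w')))
  map_smul' a w := Subtype.ext ((congrArg (A : Set E).indicator (jetPoly_smul a w)).trans
    (indicator_const_smul (A : Set E) a (jetPoly w)))

theorem jetPolyOn_apply (w : JetFiber E F k) {x : E} (hx : x ∈ A) :
    (jetPolyOn k l A w : E → F) x = jetPoly w x := indicator_of_mem (s := (A : Set E)) hx _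

theorem range_jetPolyOn : LinearMap.range (jetPolyOn (E := E) (F := F) k l A) =
    polynomials F l A k := by
  ext f
  constructor
  · rintro ⟨w, rfl⟩
    exact ⟨jetCoeff w, fun x hx => jetPolyOn_apply w hx⟩
  · rintro ⟨q, hq⟩
    obtain ⟨w, hw⟩ := exists_jetPoly_eq q
    refine ⟨w, Subtype.ext (funext fun x => ?_)⟩
    by_cases hx : x ∈ A
    · exact (jetPolyOn_apply w hx).trans ((congrFun hw x).trans (hq x hx).symm)
    · exact ((jetPolyOn k l A w).2.2 x hx).trans (f.2.2 x hx).symm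

end PolynomialSubspace

/-! ### Reduction of non-transversality to Sard's theorem. -/

variable {E F : Type} [NormedAddCommGroup E] [NormedSpace ℝ E] [FiniteDimensional ℝ E]
variable [NormedAddCommGroup F] [NormedSpace ℝ F] [FiniteDimensional ℝ F]

theorem contDiffAt_jet {k s : ℕ} {f : E → F} {x : E} (hf : ContDiffAt ℝ (k + s : ℕ) f x) :
    ContDiffAt ℝ s (jet k f) x := by
  have h : ContDiffAt ℝ s (fun y => ((y, jetProjection E F k (derivs k f y)) : Jet E F k)) x :=
    contDiffAt_id.prodMk ((jetProjection E F k).contDiff.contDiffAt.comp x (contDiffAt_derivs hf))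
  refine h.congr_of_eventuallyEq ?_
  filter_upwards [hf.eventually (by simp [-Nat.cast_add])] with y hy
  exact jet_eq (hy.of_le (by exact_mod_cast Nat.le_add_right k s))

/-- The derivative of the defining function of the manifold along the chart. -/
noncomputable def normalDeriv {G : Type*} [NormedAddCommGroup G] [NormedSpace ℝ G] {d c : ℕ}
    (φ : OpenPartialHomeomorph G (EuclideanSpace ℝ (Fin d) × EuclideanSpace ℝ (Fin c))) (y : G) :
    G →L[ℝ] EuclideanSpace ℝ (Fin c) :=
  (ContinuousLinearMap.snd ℝ (EuclideanSpace ℝ (Fin d)) (EuclideanSpace ℝ (Fin c))).comp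
    (fderiv ℝ φ y)

/-- Almost no polynomial, added to `f`, gives a jet that is not transversal to the manifold given
by the chart `φ`. -/
theorem volume_not_transversal_eq_zero {k s N d c : ℕ} (hs : 1 ≤ s) {A : Opens E} {f : E → F}
    (hf : ∀ x ∈ A, ContDiffAt ℝ (k + s : ℕ) f x)
    (φ : OpenPartialHomeomorph (Jet E F k) (EuclideanSpace ℝ (Fin d) × EuclideanSpace ℝ (Fin c)))
    (hφ : ContDiffOn ℝ s φ φ.source) (hφs : ContDiffOn ℝ s φ.symm φ.target)
    (L : (Fin N → ℝ) ≃L[ℝ] JetFiber E F k) (hd : d < s + N) :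
    volume {t : Fin N → ℝ | ∃ x ∈ A, jet k (f + jetPoly (L t)) x ∈ φ.source ∧
      (φ (jet k (f + jetPoly (L t)) x)).2 = 0 ∧
      ¬ Function.Surjective ((normalDeriv φ (jet k (f + jetPoly (L t)) x)).comp
        (fderiv ℝ (jet k (f + jetPoly (L t))) x))} = 0 := by
  have hs0 : (s : WithTop ℕ∞) ≠ 0 := by exact_mod_cast (by omega : s ≠ 0)
  have hks : ((k : ℕ) : WithTop ℕ∞) ≤ (k + s : ℕ) := by exact_mod_cast Nat.le_add_right k s
  set ι : EuclideanSpace ℝ (Fin d) → EuclideanSpace ℝ (Fin d) × EuclideanSpace ℝ (Fin c) :=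
    fun u => (u, 0) with hι
  set U : Set (EuclideanSpace ℝ (Fin d)) :=
    ι ⁻¹' (φ.target ∩ φ.symm ⁻¹' (Prod.fst ⁻¹' (A : Set E))) with hU
  have hUo : IsOpen U :=
    (φ.isOpen_inter_preimage_symm (A.isOpen.preimage continuous_fst)).preimage (by fun_prop)
  -- The parameter of the polynomial whose sum with `f` has its jet pass through the point of the
  -- manifold with coordinate `u`. A bad parameter will be a critical value of this map.
  set h : EuclideanSpace ℝ (Fin d) → Fin N → ℝ :=
    fun u => L.symm (jetDiff k f (φ.symm (ι u))) with hh
  have hsymm : ∀ z ∈ φ.target, ContDiffAt ℝ s φ.symm z := fun z hz =>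
    hφs.contDiffAt (φ.open_target.mem_nhds hz)
  have hιd : ContDiff ℝ s ι := contDiff_id.prodMk contDiff_const
  have hhU : ContDiffOn ℝ s h U := fun u hu => ContDiffAt.contDiffWithinAt
    (L.symm.contDiff.contDiffAt.comp u (ContDiffAt.comp (g := jetDiff k f)
      (f := fun u => φ.symm (ι u)) u (contDiffAt_jetDiff (hf _ hu.2))
        ((hsymm _ hu.1).comp u hιd.contDiffAt)))
  refine measure_mono_null ?_ (volume_image_not_surjective_fderiv N (EuclideanSpace ℝ (Fin d)) s U h
    hs (by simpa using hd) hUo hhU)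
  rintro t ⟨x, hx, hys, hy0, hns⟩
  set J := jet k (f + jetPoly (L t)) with hJ
  set y := J x with hy
  have hφy : φ y = ι (φ y).1 := Prod.ext rfl hy0
  have hyι : φ.symm (ι (φ y).1) = y := by rw [← hφy, φ.left_inv hys]
  have huU : (φ y).1 ∈ U := ⟨by rw [← hφy]; exact φ.map_source hys, by
    rw [mem_preimage, hyι]; exact hx⟩
  have hT : ∀ x' ∈ A, jetDiff k f (J x') = L t := fun x' hx' =>
    jetDiff_jet_add ((hf x' hx').of_le hks) (L t)
  refine ⟨(φ y).1, ⟨huU, fun hsurj => hns ?_⟩, ?_⟩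
  swap
  · change L.symm (jetDiff k f (φ.symm (ι (φ y).1))) = t
    rw [hyι, show jetDiff k f y = L t from hT x hx]
    exact L.symm_apply_apply t
  have dT : HasFDerivAt (jetDiff k f) (fderiv ℝ (jetDiff k f) y) y :=
    ((contDiffAt_jetDiff (s := s) (hf x hx)).differentiableAt hs0).hasFDerivAt
  have hJC : ContDiffAt ℝ s J x :=
    contDiffAt_jet ((hf x hx).add (contDiff_jetPoly (L t)).contDiffAt)
  have dJ : HasFDerivAt J (fderiv ℝ J x) x := (hJC.differentiableAt hs0).hasFDerivAt
  have dφ : DifferentiableAt ℝ φ y :=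
    (hφ.contDiffAt (φ.open_source.mem_nhds hys)).differentiableAt hs0
  have dφs : DifferentiableAt ℝ φ.symm (φ y) :=
    (hsymm _ (φ.map_source hys)).differentiableAt hs0
  set DT := fderiv ℝ (jetDiff k f) y with hDT
  set DJ := fderiv ℝ J x with hDJ
  have hDTDJ : ∀ v, DT (DJ v) = 0 := by
    have h1 : HasFDerivAt (fun x' => jetDiff k f (J x')) (DT.comp DJ) x :=
      HasFDerivAt.comp (g := jetDiff k f) (f := J) x dT dJ
    have h2 : HasFDerivAt (fun x' => jetDiff k f (J x')) (0 : E →L[ℝ] JetFiber E F k) x :=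
      (hasFDerivAt_const (L t) x).congr_of_eventuallyEq (by
        filter_upwards [A.isOpen.mem_nhds hx] with x' hx' using hT x' hx')
    exact fun v => congrArg (fun M : E →L[ℝ] JetFiber E F k => M v) (h1.unique h2)
  have hfstDJ : ∀ v, (DJ v).1 = v := by
    have h1 : HasFDerivAt (fun x' => (J x').1)
      ((ContinuousLinearMap.fst ℝ E (JetFiber E F k)).comp DJ) x := hasFDerivAt_fst.comp x dJ
    exact fun v => congrArg (fun M : E →L[ℝ] E => M v) (h1.unique (hasFDerivAt_id x))
  have hDh : ∀ v, fderiv ℝ h (φ y).1 v = L.symm (DT (fderiv ℝ φ.symm (φ y) (v, 0))) := by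
    have hι' : HasFDerivAt ι (ContinuousLinearMap.inl ℝ (EuclideanSpace ℝ (Fin d))
        (EuclideanSpace ℝ (Fin c))) (φ y).1 := hasFDerivAt_prodMk_left (φ y).1 0
    have h1 : HasFDerivAt φ.symm (fderiv ℝ φ.symm (φ y)) (ι (φ y).1) := by
      rw [← hφy]
      exact dφs.hasFDerivAt
    have h2 : HasFDerivAt (jetDiff k f) DT (φ.symm (ι (φ y).1)) := by rwa [hyι]
    have h3 : HasFDerivAt L.symm (L.symm : JetFiber E F k →L[ℝ] (Fin N → ℝ))
      (jetDiff k f (φ.symm (ι (φ y).1))) := L.symm.hasFDerivAt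
    have h4 : HasFDerivAt h _ (φ y).1 :=
      h3.comp (φ y).1 (HasFDerivAt.comp (g := jetDiff k f) (f := fun u => φ.symm (ι u)) (φ y).1 h2
        (h1.comp (φ y).1 hι'))
    intro v
    rw [h4.fderiv]
    rfl
  have hDTs : ∀ w, ∃ a, DT (fderiv ℝ φ.symm (φ y) (a, 0)) = w := by
    intro w
    obtain ⟨a, ha⟩ := hsurj (L.symm w)
    rw [hDh] at ha
    exact ⟨a, L.symm.injective ha⟩
  -- Both spaces have the dimension of `E`: `DJ` is injective because its first component is the
  -- identity, and `DT` is onto because it is so already on the tangent space of the manifold.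
  have hker : LinearMap.range DJ.toLinearMap = LinearMap.ker DT.toLinearMap := by
    refine Submodule.eq_of_le_of_finrank_eq ?_ ?_
    · rintro _ ⟨v, rfl⟩
      exact hDTDJ v
    · have hinj : Function.Injective DJ.toLinearMap := fun v v' hv => by
        rw [← hfstDJ v, ← hfstDJ v']
        exact congrArg Prod.fst hv
      have hrange : LinearMap.range DT.toLinearMap = ⊤ := by
        rw [LinearMap.range_eq_top]
        intro w
        obtain ⟨a, ha⟩ := hDTs w
        exact ⟨_, ha⟩
      have h1 := DT.toLinearMap.finrank_range_add_finrank_ker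
      rw [hrange, finrank_top, Module.finrank_prod] at h1
      rw [LinearMap.finrank_range_of_inj hinj]
      omega
  intro z
  -- Correcting the normal vector (0, z) by a tangent vector (a, 0) brings it into ker DT, the range
  -- of `DJ`, without changing its normal component.
  obtain ⟨a, ha⟩ := hDTs (DT (fderiv ℝ φ.symm (φ y) (0, z)))
  have hmem : fderiv ℝ φ.symm (φ y) (0, z) - fderiv ℝ φ.symm (φ y) (a, 0) ∈
      LinearMap.range DJ.toLinearMap := by
    rw [hker, LinearMap.mem_ker, map_sub]
    exact sub_eq_zero.2 ha.symm
  obtain ⟨v, hv⟩ := hmem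
  refine ⟨v, ?_⟩
  have hv' : DJ v = fderiv ℝ φ.symm (φ y) (0, z) - fderiv ℝ φ.symm (φ y) (a, 0) := hv
  change (fderiv ℝ φ y (DJ v)).2 = z
  rw [hv', map_sub, fderiv_fderiv_symm_apply hys dφ dφs, fderiv_fderiv_symm_apply hys dφ dφs]
  simp

/-! ### Closedness of the set of non-transversal functions. -/

section Closedness

variable {k : ℕ} {l : ℕ∞} {A : Opens E}

theorem continuous_jet_on {K : Set E} (hKA : K ⊆ A) (hk : (k : ℕ∞) ≤ l) :
    Continuous fun p : CFun F l A × K => jet k (p.1 : E → F) p.2 := by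
  have h : (fun p : CFun F l A × K => jet k (p.1 : E → F) p.2) = fun p =>
      ((p.2 : E), jetProjection E F k (derivs k (p.1 : E → F) p.2)) :=
    funext fun p => jet_eq (p.1.contDiffAt hk (hKA p.2.2))
  rw [h]
  refine (continuous_subtype_val.comp continuous_snd).prodMk
    ((jetProjection E F k).continuous.comp (continuous_pi fun i => ?_))
  refine continuous_iff_continuousAt.2 fun p => ?_
  have hi : ((i : ℕ) : ℕ∞) ≤ l := le_trans (by exact_mod_cast Nat.lt_succ_iff.1 i.2) hk
  exact ContinuousAt.comp (f := fun p : CFun F l A × K => (p.1, (p.2 : E)))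
    (CFun.continuousAt_iteratedFDeriv hi p.1 (hKA p.2.2)) (by fun_prop)

theorem fderiv_jet_apply {f : E → F} {x : E} (hf : ContDiffAt ℝ (k + 1 : ℕ) f x) (v : E) :
    fderiv ℝ (jet k f) x v = (v, jetProjection E F k fun i =>
      fderiv ℝ (iteratedFDeriv ℝ i f) x v) := by
  have hev : jet k f =ᶠ[𝓝 x] fun y => (y, jetProjection E F k (derivs k f y)) := by
    filter_upwards [hf.eventually (by simp)] with y hy
    exact jet_eq (hy.of_le (by exact_mod_cast Nat.le_succ k))
  have hd : HasFDerivAt (derivs k f)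
      (ContinuousLinearMap.pi fun i : Fin (k + 1) => fderiv ℝ (iteratedFDeriv ℝ i f) x) x :=
    hasFDerivAt_pi.2 fun i => (hf.differentiableAt_iteratedFDeriv (by
      exact_mod_cast i.2)).hasFDerivAt
  have h := (hasFDerivAt_id x).prodMk ((jetProjection E F k).hasFDerivAt.comp x hd)
  rw [hev.fderiv_eq]
  exact congrArg (fun M : E →L[ℝ] Jet E F k => M v) h.fderiv

theorem continuous_fderiv_jet_on {K : Set E} (hKA : K ⊆ A) (hk : ((k + 1 : ℕ) : ℕ∞) ≤ l) :
    Continuous fun p : CFun F l A × K => fderiv ℝ (jet k (p.1 : E → F)) p.2 := by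
  rw [continuous_clm_apply]
  intro v
  have h : (fun p : CFun F l A × K => fderiv ℝ (jet k (p.1 : E → F)) p.2 v) = fun p =>
      (v, jetProjection E F k fun i => fderiv ℝ (iteratedFDeriv ℝ i (p.1 : E → F)) p.2 v) :=
    funext fun p => fderiv_jet_apply (p.1.contDiffAt hk (hKA p.2.2)) v
  rw [h]
  refine continuous_const.prodMk ((jetProjection E F k).continuous.comp (continuous_pi fun i => ?_))
  refine continuous_iff_continuousAt.2 fun p => ?_
  have hi : ((i + 1 : ℕ) : ℕ∞) ≤ l := le_trans (by exact_mod_cast i.2) hk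
  have h1 : ContinuousAt (fun p : CFun F l A × K => iteratedFDeriv ℝ (i + 1) (p.1 : E → F) p.2) p :=
    ContinuousAt.comp (f := fun p : CFun F l A × K => (p.1, (p.2 : E)))
      (CFun.continuousAt_iteratedFDeriv hi p.1 (hKA p.2.2)) (by fun_prop)
  simp only [fderiv_iteratedFDeriv]
  exact ((ContinuousLinearMap.apply ℝ _ v).continuous.comp
    (continuousMultilinearCurryLeftEquiv ℝ (fun _ : Fin (i + 1) => E) F).continuous).continuousAt.comp
    h1

/-- The functions with a jet, at a point of `K`, in `D` and not transversal there. -/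
def nonTransversalSet (k : ℕ) (l : ℕ∞) (A : Opens E) {d c : ℕ} (K : Set E) (D : Set (Jet E F k))
    (φ : OpenPartialHomeomorph (Jet E F k) (EuclideanSpace ℝ (Fin d) × EuclideanSpace ℝ (Fin c))) :
    Set (CFun F l A) :=
  {f | ∃ x ∈ K, jet k (f : E → F) x ∈ D ∧ ¬ Function.Surjective
    ((normalDeriv φ (jet k (f : E → F) x)).comp (fderiv ℝ (jet k (f : E → F)) x))}

/-- The pairs (f, x) with the bad property form a closed set, since jets and their derivatives
depend continuously on both and surjectivity is open; projection along the compact `K` is a closed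
map. -/
theorem isClosed_nonTransversalSet {d c : ℕ} {K : Set E} (hK : IsCompact K) (hKA : K ⊆ A)
    {D : Set (Jet E F k)} (hD : IsClosed D) (hk : ((k + 1 : ℕ) : ℕ∞) ≤ l)
    {φ : OpenPartialHomeomorph (Jet E F k) (EuclideanSpace ℝ (Fin d) × EuclideanSpace ℝ (Fin c))}
    (hφ : ContDiffOn ℝ 1 φ φ.source) (hDφ : D ⊆ φ.source) :
    IsClosed (nonTransversalSet k l A K D φ) := by
  have hk' : (k : ℕ∞) ≤ l := le_trans (by exact_mod_cast Nat.le_succ k) hk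
  have hcompact : CompactSpace K := isCompact_iff_compactSpace.1 hK
  set Q : Set (Jet E F k × (E →L[ℝ] Jet E F k)) :=
    (D ×ˢ univ) ∩ (fun q => (normalDeriv φ q.1).comp q.2) ⁻¹' {M | ¬ Function.Surjective M} with hQ
  have hQc : IsClosed Q := by
    refine ContinuousOn.preimage_isClosed_of_isClosed ?_ (hD.prod isClosed_univ)
      isOpen_setOf_surjective.isClosed_compl
    have h1 : ContinuousOn (normalDeriv φ) D := by
      have := (hφ.continuousOn_fderiv_of_isOpen φ.open_source le_rfl).mono hDφ
      exact continuousOn_const.clm_comp this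
    exact (h1.comp continuousOn_fst fun q hq => hq.1).clm_comp continuousOn_snd
  have hpre := hQc.preimage ((continuous_jet_on (F := F) hKA hk').prodMk
    (continuous_fderiv_jet_on (F := F) hKA hk))
  have himg := isClosedMap_fst_of_compactSpace _ hpre
  convert himg using 1
  ext f
  constructor
  · rintro ⟨x, hx, h1, h2⟩
    exact ⟨(f, ⟨x, hx⟩), ⟨⟨h1, trivial⟩, h2⟩, rfl⟩
  · rintro ⟨⟨g, x⟩, ⟨⟨h1, -⟩, h2⟩, rfl⟩
    exact ⟨x, x.2, h1, h2⟩

end Closedness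

/-! ### The probe of polynomials. -/

theorem jetPolyOn_injective {k : ℕ} {l : ℕ∞} {A : Opens E} {x : E} (hx : x ∈ A) :
    Function.Injective (jetPolyOn (E := E) (F := F) k l A) := by
  rw [injective_iff_map_eq_zero]
  intro w hw
  have hev : jetPoly w =ᶠ[𝓝 x] 0 := by
    filter_upwards [A.isOpen.mem_nhds hx] with y hy
    rw [← jetPolyOn_apply (l := l) w hy, hw]
    rfl
  refine jetShift_injective (F := F) x ?_
  rw [map_zero, jetShift_apply, derivs_congr hev]
  have : derivs k (0 : E → F) x = 0 := by
    funext i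
    simp [derivs]
  rw [this, map_zero]

/-- The polynomials of degree `≤ k` are a probe for the functions with a transversal jet. -/
theorem isProbe_polynomials {n k d c : ℕ} (hn : Module.finrank ℝ E = n) {r l : ℕ∞} {A : Opens E}
    {Z : Set (Jet E F k)} (hZ : IsCManifold r d c Z) (hr : ((n - c : ℕ) : ℕ∞) < r)
    (hl : ((k + (n - c) : ℕ) : ℕ∞) < l) :
    IsProbe (polynomials F l A k)
      {f : CFun F l A | IsTransversalOn r d c (jet k (f : E → F)) A Z} := by
  -- The least integer above max(n - c, 0), a finite order even when `r` or `l` is infinite.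
  obtain ⟨s, hs⟩ : ∃ s, s = n - c + 1 := ⟨_, rfl⟩
  have hsr : (s : ℕ∞) ≤ r := by
    rw [hs]
    exact_mod_cast Order.add_one_le_of_lt hr
  have hsl : ((k + s : ℕ) : ℕ∞) ≤ l := by
    rw [hs, ← add_assoc]
    exact_mod_cast Order.add_one_le_of_lt hl
  have hs1 : 1 ≤ s := by omega
  have hr1 : (1 : ℕ∞) ≤ r := le_trans (by exact_mod_cast hs1) hsr
  have hk1 : ((k + 1 : ℕ) : ℕ∞) ≤ l := le_trans (by exact_mod_cast (by omega)) hsl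
  have hsr' : ((s : ℕ) : WithTop ℕ∞) ≤ r := by exact_mod_cast hsr
  have : ProperSpace E := FiniteDimensional.proper_real E
  have : ProperSpace (Jet E F k) := FiniteDimensional.proper_real _
  -- The empty chart is a default value for points outside `Z`, needed by `choose!`.
  have : Nonempty (OpenPartialHomeomorph (Jet E F k)
      (EuclideanSpace ℝ (Fin d) × EuclideanSpace ℝ (Fin c))) :=
    ⟨{  toFun := fun _ => 0
        invFun := fun _ => 0
        source := ∅
        target := ∅
        map_source' := by simp
        map_target' := by simp
        left_inv' := by simp
        right_inv' := by simp
        open_source := isOpen_empty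
        open_target := isOpen_empty
        continuousOn_toFun := continuousOn_empty _
        continuousOn_invFun := continuousOn_empty _ }⟩
  choose! φ hφ using hZ
  have hAball : ∀ x ∈ A, ∃ ρ > 0, Metric.closedBall x ρ ⊆ (A : Set E) := fun x hx =>
    Metric.nhds_basis_closedBall.mem_iff.1 (A.isOpen.mem_nhds hx)
  have hZball : ∀ z ∈ Z, ∃ ρ > 0, Metric.closedBall z ρ ⊆ (φ z).source := fun z hz =>
    Metric.nhds_basis_closedBall.mem_iff.1 ((φ z).open_source.mem_nhds (hφ z hz).mem_source)
  choose! α hα hαA using hAball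
  choose! β hβ hβZ using hZball
  obtain ⟨tA, htA, htAc, hcovA⟩ := countable_cover_nhdsWithin (s := (A : Set E))
    (f := fun x => Metric.closedBall x (α x))
    fun x hx => mem_nhdsWithin_of_mem_nhds (Metric.closedBall_mem_nhds x (hα x hx))
  obtain ⟨tZ, htZ, htZc, hcovZ⟩ := countable_cover_nhdsWithin (s := Z)
    (f := fun z => Metric.closedBall z (β z))
    fun z hz => mem_nhdsWithin_of_mem_nhds (Metric.closedBall_mem_nhds z (hβ z hz))
  -- `Z` need not be closed, but its part in a closed ball inside a chart domain is.
  set D : Jet E F k → Set (Jet E F k) := fun z =>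
    Metric.closedBall z (β z) ∩ (fun y => (φ z y).2) ⁻¹' {0} with hD
  set S : E → Jet E F k → Set (CFun F l A) := fun x z =>
    nonTransversalSet k l A (Metric.closedBall x (α x)) (D z) (φ z) with hS
  have hmeas : MeasurableSet (⋃ x ∈ tA, ⋃ z ∈ tZ, S x z) := by
    refine MeasurableSet.biUnion htAc fun x hx => MeasurableSet.biUnion htZc fun z hz => ?_
    have hφz := hφ z (htZ hz)
    refine (isClosed_nonTransversalSet (isCompact_closedBall _ _) (hαA x (htA hx)) ?_ hk1
      (hφz.contDiffOn.of_le (by exact_mod_cast hr1))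
      (inter_subset_left.trans (hβZ z (htZ hz)))).measurableSet
    refine ContinuousOn.preimage_isClosed_of_isClosed ?_ Metric.isClosed_closedBall
      isClosed_singleton
    exact continuous_snd.comp_continuousOn (hφz.contDiffOn.continuousOn.mono (hβZ z (htZ hz)))
  have hfin : FiniteDimensional ℝ (polynomials F l A k) := by
    rw [← range_jetPolyOn]
    infer_instance
  have b := Module.finBasis ℝ (polynomials F l A k)
  refine ⟨_, b, ⋃ x ∈ tA, ⋃ z ∈ tZ, S x z, ?_, hmeas, ?_⟩
  · intro f hf
    have hC1 : ContDiffOn ℝ 1 (jet k (f : E → F)) A := fun x hx =>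
      (contDiffAt_jet (s := 1) (f.contDiffAt hk1 hx)).contDiffWithinAt
    have hf' : ¬ IsTransversalOn r d c (jet k (f : E → F)) A Z := hf
    rw [IsTransversalOn] at hf'
    push Not at hf'
    obtain ⟨x, hx, hxZ, hne⟩ := hf' hC1
    obtain ⟨x₀, hx₀, hxx₀⟩ := mem_iUnion₂.1 (hcovA hx)
    obtain ⟨z₀, hz₀, hzz₀⟩ := mem_iUnion₂.1 (hcovZ hxZ)
    have hsrc : jet k (f : E → F) x ∈ (φ z₀).source := hβZ z₀ (htZ hz₀) hzz₀
    have hφz := hφ z₀ (htZ hz₀)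
    refine mem_iUnion₂.2 ⟨x₀, hx₀, mem_iUnion₂.2 ⟨z₀, hz₀, x, hxx₀,
      ⟨hzz₀, (hφz.mem_iff _ hsrc).1 hxZ⟩, fun hsurj => hne ?_⟩⟩
    -- A chart around `z₀` is a chart at every point of its source, and the tangent space may be
    -- computed in any chart.
    have hchart : IsSliceChart r d c Z (jet k (f : E → F) x) (φ z₀) :=
      ⟨hsrc, hφz.contDiffOn, hφz.contDiffOn_symm, hφz.mem_iff⟩
    rw [tangentSpaceAt_eq hr1 hxZ hchart, eq_top_iff]
    intro v _
    obtain ⟨e, he⟩ := hsurj (normalDeriv (φ z₀) (jet k (f : E → F) x) v)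
    refine Submodule.mem_sup.2 ⟨_, ⟨e, rfl⟩, v - fderiv ℝ (jet k (f : E → F)) x e, ?_,
      add_sub_cancel _ _⟩
    change normalDeriv (φ z₀) (jet k (f : E → F) x) (v - fderiv ℝ (jet k (f : E → F)) x e) = 0
    rw [map_sub, ← he]
    exact sub_self _
  · have hlin : LinearIndependent ℝ fun i => (b i : CFun F l A) :=
      b.linearIndependent.map' (polynomials F l A k).subtype (Submodule.ker_subtype _)
    refine isTransverse_lebesgueOnSpan hlin CFun.continuous_smul_const hmeas fun v => ?_
    simp only [mem_iUnion, ofPred_exists]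
    refine (measure_biUnion_null_iff htAc).2 fun x hx =>
      (measure_biUnion_null_iff htZc).2 fun z hz => ?_
    have hφz := hφ z (htZ hz)
    -- The ball's centre provides a point of `A`; on an empty `A` restriction of polynomials need
    -- not be injective, but then there is no ball to treat.
    let Λ : JetFiber E F k ≃ₗ[ℝ] polynomials F l A k :=
      (LinearEquiv.ofInjective _ (jetPolyOn_injective (F := F) (k := k) (l := l) (htA hx))).trans
        (LinearEquiv.ofEq _ _ range_jetPolyOn)
    have hΛ : ∀ w, ((Λ w : polynomials F l A k) : CFun F l A) = jetPolyOn k l A w := fun w => rfl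
    let L := (b.equivFun.symm.trans Λ.symm).toContinuousLinearEquiv
    have hL : ∀ t, ∑ i, t i • (b i : CFun F l A) = jetPolyOn k l A (L t) := by
      intro t
      have h1 : Λ (L t) = b.equivFun.symm t := Λ.apply_symm_apply _
      rw [← hΛ, h1, Module.Basis.equivFun_symm_apply]
      simp
    -- The relation between `d` and `c` is read off from a chart, whose derivative is an
    -- isomorphism; it yields d < s + N for Sard's theorem.
    have hdim : d + c = n + Module.finrank ℝ (polynomials F l A k) := by
      have hr0 : ((r : ℕ∞) : WithTop ℕ∞) ≠ 0 := by
        have : r ≠ 0 := by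
          rintro rfl
          simp at hr1
        exact_mod_cast this
      have h1 := finrank_eq_of_chart hφz.mem_source
        ((hφz.contDiffOn.contDiffAt ((φ z).open_source.mem_nhds hφz.mem_source)).differentiableAt
          hr0)
        ((hφz.contDiffOn_symm.contDiffAt ((φ z).open_target.mem_nhds
          ((φ z).map_source hφz.mem_source))).differentiableAt hr0)
      rw [Module.finrank_prod, Module.finrank_prod, hn, Λ.finrank_eq] at h1
      simpa using h1.symm
    refine measure_mono_null ?_ (volume_not_transversal_eq_zero hs1
      (fun y hy => v.contDiffAt hsl hy) (φ z) (hφz.contDiffOn.of_le hsr')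
      (hφz.contDiffOn_symm.of_le hsr') L (by omega))
    rintro t ⟨y, hy, ⟨hy1, hy2⟩, hy3⟩
    have hyA : y ∈ A := hαA x (htA hx) hy
    have hev : (((∑ i, t i • (b i : CFun F l A)) + v : CFun F l A) : E → F) =ᶠ[𝓝 y]
        (v : E → F) + jetPoly (L t) := by
      filter_upwards [A.isOpen.mem_nhds hyA] with y' hy'
      rw [hL, CFun.coe_add, Pi.add_apply, Pi.add_apply, jetPolyOn_apply _ hy', add_comm]
    have hjet : jet k (((∑ i, t i • (b i : CFun F l A)) + v : CFun F l A) : E → F) =ᶠ[𝓝 y]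
        jet k ((v : E → F) + jetPoly (L t)) := by
      filter_upwards [hev.eventuallyEq_nhds] with y' hy'
      exact jet_congr hy'
    rw [hjet.eq_of_nhds] at hy1 hy2 hy3
    rw [hjet.fderiv_eq] at hy3
    exact ⟨y, hyA, hβZ z (htZ hz) hy1, hy2, hy3⟩

end JetTransversality

-- In the two inequalities, `n - c` is the truncated subtraction of natural numbers, `max (n - c) 0`.
theorem mainTheorem8 (n m k d c : ℕ) (r l : ℕ∞)
    (A : TopologicalSpace.Opens (EuclideanSpace ℝ (Fin n)))
    (Z : Set (JetTransversality.Jet (EuclideanSpace ℝ (Fin n)) (EuclideanSpace ℝ (Fin m)) k))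
    (hZ : JetTransversality.IsCManifold r d c Z)
    (hr : ((n - c : ℕ) : ℕ∞) < r)
    (hl : ((k + (n - c) : ℕ) : ℕ∞) < l) :
    JetTransversality.IsPrevalent
      {f : JetTransversality.CFun (EuclideanSpace ℝ (Fin m)) l A |
        JetTransversality.IsTransversalOn r d c (JetTransversality.jet k f) A Z} ∧
    JetTransversality.IsProbe
      (JetTransversality.polynomials (EuclideanSpace ℝ (Fin m)) l A k)
      {f : JetTransversality.CFun (EuclideanSpace ℝ (Fin m)) l A |
        JetTransversality.IsTransversalOn r d c (JetTransversality.jet k f) A Z} := by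
  have h := JetTransversality.isProbe_polynomials (F := EuclideanSpace ℝ (Fin m)) (A := A)
    (finrank_euclideanSpace_fin (𝕜 := ℝ) (n := n)) hZ hr hl
  exact ⟨h.isPrevalent, h⟩
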